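/- **Setting.** A *lattice* $\Lambda$ is a finite connected directed graph with vertices $V$ and edges $E$ (loops and multiple edges allowed), an edge $e$ pointing from $i_e$ to $f_e$, together with a finite set $P$ of plaquettes, each attached along a non-empty closed edge path (for instance a cellulation of a closed surface, or of a disk). It is *simply connected* if every closed edge path can be contracted by inserting and deleting backtrackings and plaquette boundaries. A *lattice family* is a family of lattices for which the vertex degrees, the plaquette lengths and the numbers of plaquettes at an edge are bounded by one constant. For a finite group $G$, the *quantum double state* on $\Lambda$ is $|\mathcal D(G)\rangle=\mathrm{KW}^G\,|+\rangle_V\in\mathbb C[G]^{\otimes E}$, where $|+\rangle_V=\bigotimes_v |G|^{-1/2}\sum_{g\in G}|g\rangle_v$ and $\mathrm{KW}^G\bigotimes_v|g_v\rangle=\bigotimes_e|g_{i_e}^{-1}g_{f_e}\rangle$. A *ground state* of the quantum double model is a non-zero vector fixed by all vertex terms $A_v=|G|^{-1}\sum_g A_v^g$ (where $A_v^g$ multiplies the edges leaving $v$ on the left by $g$ and those entering $v$ on the right by $g^{-1}$) and by all plaquette terms $B_p$ (the projectors onto trivial holonomy around $p$). Given two families of states $\psi_\Lambda,\varphi_\Lambda$,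 each a state of finitely many qudits located at vertices of $\Lambda$, we say that $\varphi$ *can be prepared from* $\psi$ if there are constants $n,R,K$, independent of $\Lambda$, such that for every lattice of the family at most $n$ of the following operations turn $\psi_\Lambda$ deterministically into $\varphi_\Lambda$ (up to a non-zero scalar): a layer of unitary gates on disjoint sets of qudits of diameter at most $R$; the addition of ancillas in a product basis state (at most $K$ per vertex, each of dimension at most $K$); a simultaneous measurement of single qudits in their bases, which are then removed. Later operations may depend on all earlier measurement outcomes (feedforward), and the protocol must succeed for all outcomes of non-zero probability. Two families are in the same *measurement-equivalent phase* if each can be prepared from the other. A family is in the *trivial* phase if it is in the same phase as every family of product states of qudits of uniformly bounded dimension and number per vertex. **Lemma.** Let $G$ be a finite group, $G_p$ its perfect core (its largest perfect subgroup) and $G_{pc}=G_p/Z(G_p)$. 1. $G_{pc}$ is perfect and centerless. 2. On every lattice, $|\mathcal D(G)\rangle$ is a ground state of the quantum double model; on a simply connected lattice it is the only one up to a scalar. 3. On every family of simply connected lattices, $\mathcal D(G)$ is in the same measurement-equivalent phase as $\mathcal D(G_{pc})$. 4. On every lattice family, of any topology, $\mathcal D(G)$ is in the same measurement-equivalent phase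 as $\mathcal D(G_p)$. 5. In particular, if $G$ is solvable, then $\mathcal D(G)$ is in the trivial measurement-equivalent phase on every lattice family. -/

import Mathlib

noncomputable section

/-! ### Group theory -/

/-- The perfect core of a group: the join of all its perfect subgroups. -/
def perfectCore (G : Type) [Group G] : Subgroup G :=
  sSup {H : Subgroup G | ⁅H, H⁆ = H}

/-- The perfect core is the largest perfect subgroup. -/
theorem isGreatest_perfectCore (G : Type) [Group G] :
    IsGreatest {H : Subgroup G | ⁅H, H⁆ = H} (perfectCore G) := by
  refine ⟨le_antisymm ?_ ?_, fun H hH => le_sSup hH⟩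
  · exact Subgroup.commutator_le_self _
  · refine sSup_le fun H hH => ?_
    have hle : H ≤ perfectCore G := le_sSup hH
    have hH' : ⁅H, H⁆ = H := hH
    calc H = ⁅H, H⁆ := hH'.symm
      _ ≤ ⁅perfectCore G, perfectCore G⁆ := Subgroup.commutator_mono hle hle

/-- The central quotient of the perfect core. -/
abbrev PerfectCenterless (G : Type) [Group G] : Type :=
  perfectCore G ⧸ Subgroup.center (perfectCore G)

instance (G : Type) [Group G] [Fintype G] : Fintype (perfectCore G) := Fintype.ofFinite _

instance (G : Type) [Group G] [Fintype G] : Fintype (PerfectCenterless G) := Fintype.ofFinite _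

/-! ### Lattices -/

/-- A lattice: a finite directed graph (loops and multiple edges are allowed)
together with finitely many plaquettes, each attached along a closed path of edges.
A directed edge traversed forwards is `(e, true)`, traversed backwards `(e, false)`. -/
structure SpaceLattice where
  V : Type
  E : Type
  P : Type
  [fintypeV : Fintype V]
  [fintypeE : Fintype E]
  [fintypeP : Fintype P]
  src : E → V
  tgt : E → V
  bdry : P → List (E × Bool)

attribute [instance] SpaceLattice.fintypeV SpaceLattice.fintypeE SpaceLattice.fintypeP

namespace SpaceLattice

variable (Λ : SpaceLattice)

/-- Initial vertex of an oriented edge. -/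
def start (d : Λ.E × Bool) : Λ.V := if d.2 then Λ.src d.1 else Λ.tgt d.1

/-- Final vertex of an oriented edge. -/
def finish (d : Λ.E × Bool) : Λ.V := if d.2 then Λ.tgt d.1 else Λ.src d.1

/-- `IsPath u l v`: the list `l` of oriented edges is a path from `u` to `v`. -/
def IsPath : Λ.V → List (Λ.E × Bool) → Λ.V → Prop
  | u, [], v => u = v
  | u, d :: l, v => Λ.start d = u ∧ IsPath (Λ.finish d) l v

/-- The underlying simple graph on the vertices, used to measure distances. -/
def graph : SimpleGraph Λ.V := SimpleGraph.fromRel fun u v => ∃ e, Λ.src e = u ∧ Λ.tgt e = v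

/-- Well-formedness: the graph is connected, and each plaquette boundary is a closed path
with at least one edge. -/
structure IsCellulation : Prop where
  connected : Λ.graph.Connected
  bdry_ne_nil : ∀ p, Λ.bdry p ≠ []
  bdry_closed : ∀ p, ∃ v, Λ.IsPath v (Λ.bdry p) v

/-- Elementary homotopies between paths from `u` to `v`: deletion of a backtracking
and deletion of a plaquette boundary. -/
inductive HomotopyStep (u v : Λ.V) : List (Λ.E × Bool) → List (Λ.E × Bool) → Prop
  | backtrack (l₁ l₂ : List (Λ.E × Bool)) (e : Λ.E) (b : Bool)
      (h : Λ.IsPath u (l₁ ++ [(e, b), (e, !b)] ++ l₂) v) :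
      HomotopyStep u v (l₁ ++ [(e, b), (e, !b)] ++ l₂) (l₁ ++ l₂)
  | plaquette (l₁ l₂ : List (Λ.E × Bool)) (p : Λ.P)
      (h : Λ.IsPath u (l₁ ++ Λ.bdry p ++ l₂) v) (h' : Λ.IsPath u (l₁ ++ l₂) v) :
      HomotopyStep u v (l₁ ++ Λ.bdry p ++ l₂) (l₁ ++ l₂)

/-- The edge-path group is trivial: every closed path is homotopic to the constant path. -/
def SimplyConnected : Prop :=
  ∀ (v : Λ.V) (l : List (Λ.E × Bool)), Λ.IsPath v l v →
    Relation.EqvGen (Λ.HomotopyStep v v) l []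

/-- Geometry bounded by `D`: at most `D` edges at each vertex, at most `D` edges around each
plaquette, at most `D` plaquettes at each edge. -/
structure BoundedBy (D : ℕ) : Prop where
  degree : ∀ v, Nat.card {e : Λ.E // Λ.src e = v ∨ Λ.tgt e = v} ≤ D
  length : ∀ p, (Λ.bdry p).length ≤ D
  codegree : ∀ e, Nat.card {p : Λ.P // ∃ b, (e, b) ∈ Λ.bdry p} ≤ D

end SpaceLattice

/-- A family of lattices (of growing size, say) with uniformly bounded local geometry. -/
def IsLatticeFamily {ι : Type} (Λ : ι → SpaceLattice) : Prop :=
  (∀ i, (Λ i).IsCellulation) ∧ ∃ D, ∀ i, (Λ i).BoundedBy D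

/-! ### Many-body states -/

/-- A finite collection of qudits, each located at a point of `V`;
the qudit `s` has the orthonormal basis `X s`. -/
structure QSystem (V : Type) where
  Site : Type
  X : Site → Type
  loc : Site → V
  [fintypeSite : Fintype Site]
  [fintypeX : ∀ s, Fintype (X s)]

attribute [instance] QSystem.fintypeSite QSystem.fintypeX

namespace QSystem

variable {V : Type}

/-- Basis configurations of the many-body Hilbert space. -/
abbrev Config (S : QSystem V) : Type := ∀ s, S.X s

/-- Vectors of the many-body Hilbert space, in the basis of configurations. -/
abbrev State (S : QSystem V) : Type := S.Config → ℂ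

/-- At most `K` qudits at each location, each of dimension at most `K`. -/
def BoundedBy (S : QSystem V) (K : ℕ) : Prop :=
  (∀ v, Nat.card {s : S.Site // S.loc s = v} ≤ K) ∧ ∀ s, Nat.card (S.X s) ≤ K

/-- The qudits of `S` and those of `A` together. -/
def join (S A : QSystem V) : QSystem V where
  Site := S.Site ⊕ A.Site
  X := Sum.elim S.X A.X
  loc := Sum.elim S.loc A.loc
  fintypeX := fun s => match s with
    | .inl s => S.fintypeX s
    | .inr a => A.fintypeX a

/-- The configuration of the joint system made of one of `S` and one of `A`. -/
def joinConfig {S A : QSystem V} (x : S.Config) (a : A.Config) : (S.join A).Config :=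
  fun s => match s with
    | .inl s => x s
    | .inr t => a t

open scoped Classical in
/-- The state `ψ ⊗ |a⟩`. -/
def addAncilla {S A : QSystem V} (ψ : S.State) (a : A.Config) : (S.join A).State :=
  fun x => if (fun t => x (.inr t)) = a then ψ (fun s => x (.inl s)) else 0

/-- The (unnormalized) state `⟨a|ψ` of the remaining qudits `S`, after every qudit of `A` was
measured in its basis with joint outcome `a`. -/
def postMeasurement {S A : QSystem V} (ψ : (S.join A).State) (a : A.Config) : S.State :=
  fun x => ψ (joinConfig x a)

/-- A renaming of the qudits and of their basis vectors that keeps each qudit in its place. -/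
structure Iso (S T : QSystem V) where
  site : S.Site ≃ T.Site
  basis : ∀ s, S.X s ≃ T.X (site s)
  loc_site : ∀ s, T.loc (site s) = S.loc s

/-- Transport of a state along a renaming. -/
def Iso.map {S T : QSystem V} (f : S.Iso T) (ψ : S.State) : T.State :=
  fun y => ψ fun s => (f.basis s).symm (y (f.site s))

/-- Product states. -/
def IsProduct {S : QSystem V} (ψ : S.State) : Prop :=
  ∃ φ : ∀ s, S.X s → ℂ, (∀ s, φ s ≠ 0) ∧ ∀ x, ψ x = ∏ s, φ s (x s)

open scoped Classical in
/-- One layer of a circuit of range `R`: the qudits are partitioned into blocks of diameter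
at most `R`, and a unitary gate acts on each block. -/
structure Layer (Γ : SimpleGraph V) (R : ℕ) (S : QSystem V) where
  Block : Type
  [fintypeBlock : Fintype Block]
  block : S.Site → Block
  diam_le : ∀ s t, block s = block t → Γ.edist (S.loc s) (S.loc t) ≤ R
  gate : ∀ β : Block, Matrix (∀ s : {s // block s = β}, S.X s) (∀ s : {s // block s = β}, S.X s) ℂ
  gate_unitary : ∀ β, gate β ∈ Matrix.unitaryGroup (∀ s : {s // block s = β}, S.X s) ℂ

attribute [instance] Layer.fintypeBlock

open scoped Classical in
/-- Action of the tensor product of all the gates of a layer. -/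
def Layer.apply {Γ : SimpleGraph V} {R : ℕ} {S : QSystem V} (L : Layer Γ R S) (ψ : S.State) :
    S.State :=
  fun x => ∑ y : S.Config, (∏ β, L.gate β (fun s => x s.1) (fun s => y s.1)) * ψ y

end QSystem

/-! ### Preparation by local circuits, measurements and feedforward -/

open QSystem in
/-- `Prep Γ R K φ n ψ`: a protocol with at most `n` operations (time steps) deterministically
turns the state `ψ` into the state `φ`, up to a scalar. An operation is a layer of unitary gates
of range `R`, the addition of ancillas in a basis state (at most `K` at each location, of
dimension at most `K`), or a simultaneous measurement of individual qudits. The continuation of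
the protocol after a measurement may depend on the outcomes at all sites (feedforward), and must
succeed for each outcome that has non-zero probability. -/
inductive Prep {V : Type} (Γ : SimpleGraph V) (R K : ℕ) {T : QSystem V} (φ : T.State) :
    ℕ → ∀ {S : QSystem V}, S.State → Prop
  | done (n : ℕ) (ψ : T.State) (c : ℂ) (hc : c ≠ 0) (h : ψ = c • φ) : Prep Γ R K φ n ψ
  | rename {n : ℕ} {S S' : QSystem V} (ψ : S.State) (f : S.Iso S')
      (h : Prep Γ R K φ n (f.map ψ)) : Prep Γ R K φ n ψ
  | unitary {n : ℕ} {S : QSystem V} (ψ : S.State) (L : Layer Γ R S)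
      (h : Prep Γ R K φ n (L.apply ψ)) : Prep Γ R K φ (n + 1) ψ
  | ancilla {n : ℕ} {S : QSystem V} (ψ : S.State) (A : QSystem V) (hA : A.BoundedBy K)
      (a : A.Config) (h : Prep Γ R K φ n (addAncilla ψ a)) : Prep Γ R K φ (n + 1) ψ
  | measure {n : ℕ} {S A : QSystem V} (ψ : (S.join A).State)
      (h : ∀ a : A.Config, postMeasurement ψ a ≠ 0 → Prep Γ R K φ n (postMeasurement ψ a)) :
      Prep Γ R K φ (n + 1) ψ

/-- A many-body state on each member of a family of lattices. -/
structure StateFamily {ι : Type} (Λ : ι → SpaceLattice) where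
  sys : ∀ i, QSystem (Λ i).V
  state : ∀ i, (sys i).State

namespace StateFamily

variable {ι : Type} {Λ : ι → SpaceLattice}

/-- `F'` can be prepared deterministically from `F` by finitely many rounds of finite-depth local
circuits, measurements and feedforward: number of operations, range of the gates and amount of
ancillas do not depend on the lattice. -/
def Prepares (F F' : StateFamily Λ) : Prop :=
  ∃ n R K : ℕ, ∀ i, Prep (Λ i).graph R K (F'.state i) n (F.state i)

/-- The same measurement-equivalent phase. -/
def MeasurementEquivalent (F F' : StateFamily Λ) : Prop :=
  F.Prepares F' ∧ F'.Prepares F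

/-- The trivial measurement-equivalent phase: that of the product states of qudits with uniformly
bounded density and dimension. -/
def InTrivialPhase (F : StateFamily Λ) : Prop :=
  ∀ F' : StateFamily Λ, (∀ i, QSystem.IsProduct (F'.state i)) → (∃ K, ∀ i, (F'.sys i).BoundedBy K) →
    F.MeasurementEquivalent F'

end StateFamily

/-! ### Quantum doubles -/

namespace QuantumDouble

variable (G : Type) [Group G] [Fintype G] (Λ : SpaceLattice)

/-- The Hilbert space `ℂ[G]^{⊗ E}`: one `G`-qudit on each edge. -/
def sys : QSystem Λ.V where
  Site := Λ.E
  X := fun _ => G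
  loc := Λ.src

variable {G Λ}

/-- Ordered product of the edge variables along a path. -/
def holonomy (x : Λ.E → G) (l : List (Λ.E × Bool)) : G :=
  (l.map fun d => if d.2 then x d.1 else (x d.1)⁻¹).prod

open scoped Classical in
/-- The gauge transformation at `v`: left multiplication by `g` on the edges that leave `v`, right
multiplication by `g⁻¹` on the edges that enter `v`. -/
def gaugeAt (v : Λ.V) (g : G) (x : Λ.E → G) : Λ.E → G :=
  fun e => (if Λ.src e = v then g else 1) * x e * (if Λ.tgt e = v then g⁻¹ else 1)

/-- The vertex term `A_v = |G|⁻¹ ∑ g, A_v^g`, where `A_v^g |x⟩ = |gaugeAt v g x⟩`. -/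
def vertexTerm (v : Λ.V) (ψ : (sys G Λ).State) : (sys G Λ).State :=
  fun x => (Fintype.card G : ℂ)⁻¹ * ∑ g : G, ψ (gaugeAt v g⁻¹ x)

open scoped Classical in
/-- The plaquette term `B_p`: the projector onto trivial holonomy around `p`. -/
def plaquetteTerm (p : Λ.P) (ψ : (sys G Λ).State) : (sys G Λ).State :=
  fun x => if holonomy (G := G) x (Λ.bdry p) = 1 then ψ x else 0

/-- Ground states of the quantum double model `- ∑ v, A_v - ∑ p, B_p` (frustration-free). -/
structure IsGroundState (ψ : (sys G Λ).State) : Prop where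
  ne_zero : ψ ≠ 0
  vertex : ∀ v, vertexTerm v ψ = ψ
  plaquette : ∀ p, plaquetteTerm p ψ = ψ

variable (G Λ)

open scoped Classical in
/-- The Kramers-Wannier map from the vertices to the edges,
`⨂ v, |g v⟩ ↦ ⨂ e, |(g (src e))⁻¹ * g (tgt e)⟩`. -/
def KW (φ : (Λ.V → G) → ℂ) : (sys G Λ).State :=
  fun x => ∑ g : Λ.V → G, if x = (fun e => (g (Λ.src e))⁻¹ * g (Λ.tgt e)) then φ g else 0

/-- The symmetric product state `⨂ v, |+⟩` with `|+⟩ = |G|^(-1/2) ∑ g, |g⟩`. -/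
def plus : (Λ.V → G) → ℂ :=
  fun _ => ∏ _v : Λ.V, ((Real.sqrt (Fintype.card G) : ℝ) : ℂ)⁻¹

/-- The quantum double state `|D(G)⟩ = KW |+⟩`. -/
def gs : (sys G Λ).State := KW G Λ (plus G Λ)

/-- The quantum double states of `G` on a family of lattices. -/
def family {ι : Type} (Λ : ι → SpaceLattice) : StateFamily Λ where
  sys := fun i => sys G (Λ i)
  state := fun i => gs G (Λ i)

end QuantumDouble

end

/-! A G-labelling of the edges is called a pure gauge if it is the coboundary of a vertex labelling.
On a connected lattice two potentials have the same coboundary exactly when they differ by a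
constant left factor, so the Kramers-Wannier image of the plus state is a multiple of the uniform
superposition of pure gauges (`gs_eq`). This set is invariant under gauge transformations and has
trivial plaquette holonomy, which gives the ground state property. On a simply connected lattice
every flat labelling is a pure gauge (`isPureGauge_iff`), which gives uniqueness.

The phase statements rest on two kinds of group extension. For a normal subgroup N of G with abelian
quotient Q, `prep_of_exact` measures the Q-part of every edge and undoes the outcome by an edgewise
correction chosen from all outcomes. In the other direction, `prep_of_exact_abelian` couples fresh
Q-qudits on the vertices to the edges and then measures them in the character basis. For a central
extension of K by Z on a simply connected lattice, `prep_quotient_of_central` measures the Z-part of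
the edges in the character basis, and `prep_of_central_quotient` adds a uniform Z-part, measures the
plaquette fluxes and cancels them.

Every character measurement leaves a sum of a character over the fibres of a homomorphism. By
`exists_sum_fiber_eq` an outcome of non-zero amplitude yields only a phase given by a character of
the target. Such a phase is a product of local phases, so a local circuit removes it.

The derived series of a finite group stabilises at the perfect core, and its successive quotients
are abelian. This proves the equivalence of G with its perfect core on every topology. If G is
solvable the core is trivial and its state is a product. One central extension leads from the core
to its central quotient, which is centerless by Grün's lemma.

All local operations are reduced to writing a local function into new qudits and erasing it again
(`of_compute`, `of_uncompute`), both consequences of `of_ctrlSwap`. -/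

noncomputable section

/-! ### Gate layers and the calculus of preparation protocols. -/

section

namespace QSystem

variable {V : Type}

open scoped Classical in
/-- A block-local involution of the configurations is implemented by one layer of gates. -/
theorem Layer.exists_apply_of_involutive {Γ : SimpleGraph V} {R : ℕ} {W : QSystem V}
    (w₀ : W.Config) {B : Type} [Fintype B] (block : W.Site → B)
    (hd : ∀ s t, block s = block t → Γ.edist (W.loc s) (W.loc t) ≤ R)
    (σ : W.Config → W.Config) (hσ : ∀ x, σ (σ x) = x)
    (hloc : ∀ x y s, (∀ t, block t = block s → x t = y t) → σ x s = σ y s) :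
    ∃ L : Layer Γ R W, ∀ ψ x, L.apply ψ x = ψ (σ x) := by
  -- A block configuration is completed by `w₀` so that `σ` can act on it. By locality the result on
  -- the block does not depend on `w₀`, and the gate is the permutation matrix of the resulting
  -- involution.
  let ext : ∀ β : B, (∀ s : {s // block s = β}, W.X s) → W.Config := fun β u s =>
    if h : block s = β then u ⟨s, h⟩ else w₀ s
  let res : ∀ β : B, W.Config → (∀ s : {s // block s = β}, W.X s) := fun β x s => x s.1
  let π : ∀ β : B, (∀ s : {s // block s = β}, W.X s) → (∀ s : {s // block s = β}, W.X s) :=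
    fun β u => res β (σ (ext β u))
  have hext : ∀ β u (s : {s // block s = β}), ext β u s.1 = u s := by
    intro β u s
    simp [ext, s.2]
  have hπ' : ∀ β x, π β (res β x) = res β (σ x) := by
    intro β x
    funext s
    refine hloc _ _ _ fun t ht => ?_
    exact hext β (res β x) ⟨t, ht.trans s.2⟩
  have hres : ∀ β u, res β (ext β u) = u := fun β u => funext fun s => hext β u s
  have hπ : ∀ β u, π β (π β u) = u := by
    intro β u
    change π β (res β (σ (ext β u))) = u
    rw [hπ', hσ, hres]
  let L : Layer Γ R W :=
    { Block := B
      block := block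
      diam_le := hd
      gate := fun β => Matrix.of fun u v => if π β u = v then 1 else 0
      gate_unitary := by
        intro β
        rw [Matrix.mem_unitaryGroup_iff]
        ext u v
        have hinj : π β u = π β v ↔ u = v :=
          ⟨fun h => by rw [← hπ β u, h, hπ], fun h => by rw [h]⟩
        simp [Matrix.mul_apply, Matrix.star_apply, Matrix.one_apply, hinj, eq_comm] }
  refine ⟨L, fun ψ x => ?_⟩
  have hprod : ∀ y : W.Config,
      (∏ β, L.gate β (fun s => x s.1) (fun s => y s.1)) = if σ x = y then 1 else 0 := by
    intro y
    have h1 : ∀ β, L.gate β (fun s => x s.1) (fun s => y s.1) =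
        if res β (σ x) = res β y then 1 else 0 := by
      intro β
      rw [← hπ' β x]
      rfl
    simp only [h1]
    rw [Finset.prod_ite_zero]
    simp only [Finset.prod_const_one, Finset.mem_univ, true_implies]
    congr 1
    apply propext
    constructor
    · intro h
      funext s
      exact congrFun (h (block s)) ⟨s, rfl⟩
    · rintro rfl β
      rfl
  simp only [Layer.apply, hprod]
  simp

open scoped Classical in
/-- Simultaneous unitaries on all the qudits form one layer of gates. -/
theorem Layer.exists_apply_of_site (Γ : SimpleGraph V) (R : ℕ) {W : QSystem V}
    (U : ∀ s, Matrix (W.X s) (W.X s) ℂ) (hU : ∀ s, U s ∈ Matrix.unitaryGroup (W.X s) ℂ) :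
    ∃ L : Layer Γ R W, ∀ ψ x, L.apply ψ x = ∑ y : W.Config, (∏ s, U s (x s) (y s)) * ψ y := by
  let L : Layer Γ R W :=
    { Block := W.Site
      block := id
      diam_le := by
        rintro s t rfl
        simp
      gate := fun β => Matrix.of fun u v => U β (u ⟨β, rfl⟩) (v ⟨β, rfl⟩)
      gate_unitary := by
        intro β
        let e : (∀ s : {s // id s = β}, W.X s) ≃ W.X β :=
          { toFun := fun u => u ⟨β, rfl⟩
            invFun := fun a s => cast (congrArg W.X s.2.symm) a
            left_inv := by
              intro u
              funext ⟨s, hs⟩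
              cases hs
              rfl
            right_inv := fun a => rfl }
        have h : (Matrix.of fun u v => U β (u ⟨β, rfl⟩) (v ⟨β, rfl⟩)) = (U β).submatrix e e := rfl
        rw [h, Matrix.mem_unitaryGroup_iff, Matrix.star_eq_conjTranspose,
          Matrix.conjTranspose_submatrix, Matrix.submatrix_mul_equiv,
          ← Matrix.star_eq_conjTranspose, Matrix.mem_unitaryGroup_iff.1 (hU β),
          Matrix.submatrix_one_equiv] }
  exact ⟨L, fun ψ x => rfl⟩

end QSystem

open QSystem

variable {V : Type} {Γ : SimpleGraph V}

/-- A layer of range `R` is a layer of any larger range. -/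
def QSystem.Layer.widen {R R' : ℕ} (h : R ≤ R') {S : QSystem V} (L : Layer Γ R S) :
    Layer Γ R' S where
  Block := L.Block
  block := L.block
  diam_le := fun s t hst => (L.diam_le s t hst).trans (by exact_mod_cast h)
  gate := L.gate
  gate_unitary := L.gate_unitary

theorem QSystem.BoundedBy.mono {S : QSystem V} {K K' : ℕ} (h : S.BoundedBy K) (hK : K ≤ K') :
    S.BoundedBy K' :=
  ⟨fun v => (h.1 v).trans hK, fun s => (h.2 s).trans hK⟩

namespace Prep

theorem mono {R R' K K' : ℕ} (hR : R ≤ R') (hK : K ≤ K') {T : QSystem V} {φ : T.State} {n : ℕ}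
    {S : QSystem V} {ψ : S.State} (h : Prep Γ R K φ n ψ) :
    ∀ {n' : ℕ}, n ≤ n' → Prep Γ R' K' φ n' ψ := by
  induction h with
  | done n ψ c hc h => exact fun _ => .done _ ψ c hc h
  | rename ψ f h ih => exact fun hn => .rename ψ f (ih hn)
  | unitary ψ L h ih =>
    intro n' hn
    obtain ⟨m, rfl⟩ : ∃ m, n' = m + 1 := ⟨n' - 1, by omega⟩
    exact .unitary ψ (L.widen hR) (ih (by omega))
  | ancilla ψ A hA a h ih =>
    intro n' hn
    obtain ⟨m, rfl⟩ : ∃ m, n' = m + 1 := ⟨n' - 1, by omega⟩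
    exact .ancilla ψ A (hA.mono hK) a (ih (by omega))
  | measure ψ h ih =>
    intro n' hn
    obtain ⟨m, rfl⟩ : ∃ m, n' = m + 1 := ⟨n' - 1, by omega⟩
    exact .measure ψ fun a ha => ih a ha (by omega)

/-- Every operation is linear and states are never normalised, so the same protocol serves a
multiple of the state. Concatenation needs this, because a protocol reaches its target only up to a
scalar. -/
theorem smul {R K : ℕ} {T : QSystem V} {φ : T.State} {n : ℕ} {S : QSystem V} {ψ : S.State}
    (h : Prep Γ R K φ n ψ) (c : ℂ) (hc : c ≠ 0) : Prep Γ R K φ n (c • ψ) := by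
  induction h with
  | done n ψ c' hc' h => exact .done _ _ (c * c') (mul_ne_zero hc hc') (by rw [h, mul_smul])
  | rename ψ f h ih => exact .rename _ f ih
  | unitary ψ L h ih =>
    refine .unitary _ L ?_
    have : L.apply (c • ψ) = c • L.apply ψ := by
      funext x
      simp only [Layer.apply, Pi.smul_apply, smul_eq_mul, Finset.mul_sum]
      exact Finset.sum_congr rfl fun y _ => by ring
    rwa [this]
  | ancilla ψ A hA a h ih =>
    refine .ancilla _ A hA a ?_
    have : addAncilla (c • ψ) a = c • addAncilla ψ a := by
      funext x
      simp only [addAncilla, Pi.smul_apply, smul_eq_mul, mul_ite, mul_zero]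
      rfl
    rwa [this]
  | measure ψ h ih =>
    refine .measure _ fun a ha => ?_
    have : postMeasurement (c • ψ) a = c • postMeasurement ψ a := rfl
    rw [this] at ha ⊢
    exact ih a fun h0 => ha (by rw [h0, smul_zero])

theorem trans {R K : ℕ} {T T' : QSystem V} {φ : T.State} {χ : T'.State} {n m : ℕ}
    {S : QSystem V} {ψ : S.State} (h : Prep Γ R K φ n ψ) (h' : Prep Γ R K χ m φ) :
    Prep Γ R K χ (n + m) ψ := by
  induction h with
  | done n ψ c hc h => exact h ▸ (h'.smul c hc).mono le_rfl le_rfl (by omega)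
  | rename ψ f h ih => exact .rename ψ f ih
  | @unitary n _ ψ L h ih =>
    rw [show n + 1 + m = (n + m) + 1 by omega]
    exact .unitary ψ L ih
  | @ancilla n _ ψ A hA a h ih =>
    rw [show n + 1 + m = (n + m) + 1 by omega]
    exact .ancilla ψ A hA a ih
  | @measure n _ _ ψ h ih =>
    rw [show n + 1 + m = (n + m) + 1 by omega]
    exact .measure ψ fun a ha => ih a ha

end Prep

theorem StateFamily.Prepares.trans {ι : Type} {Λ : ι → SpaceLattice} {F F' F'' : StateFamily Λ}
    (h : F.Prepares F') (h' : F'.Prepares F'') : F.Prepares F'' := by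
  obtain ⟨n, R, K, h⟩ := h
  obtain ⟨n', R', K', h'⟩ := h'
  exact ⟨n + n', max R R', max K K', fun i =>
    ((h i).mono (le_max_left _ _) (le_max_left _ _) le_rfl).trans
      ((h' i).mono (le_max_right _ _) (le_max_right _ _) le_rfl)⟩

theorem StateFamily.MeasurementEquivalent.trans {ι : Type} {Λ : ι → SpaceLattice}
    {F F' F'' : StateFamily Λ} (h : F.MeasurementEquivalent F')
    (h' : F'.MeasurementEquivalent F'') : F.MeasurementEquivalent F'' :=
  ⟨h.1.trans h'.1, h'.2.trans h.2⟩

end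

/-! ### Local reversible computation. -/

section

namespace QSystem

variable {V : Type}

open scoped Classical in
/-- The number `z` if `p` holds, and zero otherwise. -/
def guarded (p : Prop) (z : ℂ) : ℂ := if p then z else 0

theorem guarded_pos {p : Prop} (h : p) (z : ℂ) : guarded p z = z := if_pos h

theorem guarded_neg {p : Prop} (h : ¬p) (z : ℂ) : guarded p z = 0 := if_neg h

theorem guarded_congr {p q : Prop} (h : p ↔ q) (z : ℂ) : guarded p z = guarded q z := by
  rw [propext h]

theorem guarded_ne_zero {p : Prop} {z : ℂ} : guarded p z ≠ 0 ↔ p ∧ z ≠ 0 := by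
  by_cases h : p <;> simp [guarded, h]

theorem mul_guarded (p : Prop) (c z : ℂ) : c * guarded p z = guarded p (c * z) := by
  by_cases h : p <;> simp [guarded, h]

/-- A map of configurations each of whose output qudits reads at most `M` input qudits,
at distance at most `r`. -/
def IsLocalMap (Γ : SimpleGraph V) (r M : ℕ) {S T : QSystem V} (f : S.Config → T.Config) : Prop :=
  ∃ reads : T.Site → List S.Site, (∀ t, (reads t).length ≤ M) ∧
    (∀ t, ∀ s ∈ reads t, Γ.edist (T.loc t) (S.loc s) ≤ r) ∧
    ∀ t x y, (∀ s ∈ reads t, x s = y s) → f x t = f y t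

/-- The system with one copy of the qudit `s` at the location of `t`,
for each qudit `s` read by `t`. -/
def copies {S T : QSystem V} (reads : T.Site → List S.Site) : QSystem V where
  Site := {p : T.Site × S.Site // p.2 ∈ reads p.1}
  X := fun p => S.X p.1.2
  loc := fun p => T.loc p.1.1
  fintypeSite := Fintype.ofFinite _

/-- A copy at a given location is determined by its reader, one of at most `k`, and by the position
of its source in the reader's list, one of at most `M`. -/
theorem copies_boundedBy {S T : QSystem V} {reads : T.Site → List S.Site} {k M K : ℕ}
    (hM : ∀ t, (reads t).length ≤ M) (hT : ∀ v, Nat.card {t : T.Site // T.loc t = v} ≤ k)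
    (hX : ∀ s, Nat.card (S.X s) ≤ K) (hK : k * M ≤ K) : (copies reads).BoundedBy K := by
  classical
  refine ⟨fun v => ?_, fun p => hX p.1.2⟩
  let g : {p : (copies reads).Site // (copies reads).loc p = v} →
      {t : T.Site // T.loc t = v} × Fin M := fun p =>
    (⟨p.1.1.1, p.2⟩, ⟨(reads p.1.1.1).idxOf p.1.1.2,
      (List.idxOf_lt_length_of_mem p.1.2).trans_le (hM _)⟩)
  have hg : Function.Injective g := by
    rintro ⟨⟨⟨t, s⟩, hs⟩, h⟩ ⟨⟨⟨t', s'⟩, hs'⟩, h'⟩ hpq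
    simp only [g, Prod.mk.injEq, Fin.mk.injEq] at hpq
    obtain ⟨ht, hi⟩ := hpq
    obtain rfl : t = t' := congrArg Subtype.val ht
    have := (List.idxOf_inj (l := reads t) hs).1 hi
    subst this
    rfl
  calc _ ≤ Nat.card ({t : T.Site // T.loc t = v} × Fin M) := Nat.card_le_card_of_injective g hg
    _ ≤ k * M := by
      rw [Nat.card_prod, Nat.card_fin]
      exact Nat.mul_le_mul_right _ (hT v)
    _ ≤ K := hK

/-- The part of a joint configuration on the first system. -/
def left {S A : QSystem V} (w : (S.join A).Config) : S.Config := fun s => w (.inl s)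

/-- The part of a joint configuration on the second system. -/
def right {S A : QSystem V} (w : (S.join A).Config) : A.Config := fun t => w (.inr t)

@[simp]
theorem left_joinConfig {S A : QSystem V} (x : S.Config) (a : A.Config) :
    left (joinConfig x a) = x := rfl

@[simp]
theorem right_joinConfig {S A : QSystem V} (x : S.Config) (a : A.Config) :
    right (joinConfig x a) = a := rfl

@[simp]
theorem joinConfig_left_right {S A : QSystem V} (w : (S.join A).Config) :
    joinConfig (left w) (right w) = w := by
  funext u
  cases u <;> rfl

theorem addAncilla_apply {S A : QSystem V} (ψ : S.State) (a : A.Config) (w : (S.join A).Config) :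
    addAncilla ψ a w = guarded (right w = a) (ψ (left w)) := by
  by_cases h : right w = a
  · rw [guarded_pos h]
    exact if_pos h
  · rw [guarded_neg h]
    exact if_neg h

open scoped Classical in
/-- The controlled permutation `|x⟩|y⟩ ↦ |x⟩|(y₀ f(x)) y⟩`, with transpositions acting
on each output qudit. -/
def ctrlSwap {S T : QSystem V} (f : S.Config → T.Config) (y₀ : T.Config)
    (w : (S.join T).Config) : (S.join T).Config :=
  joinConfig (left w) (fun t => Equiv.swap (y₀ t) (f (left w) t) (right w t))

open scoped Classical in
/-- The permutation that copies the qudits of `S` to blank copies. -/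
def copyPerm {S T : QSystem V} (reads : T.Site → List S.Site) (x₀ : S.Config)
    (w : ((S.join T).join (copies reads)).Config) : ((S.join T).join (copies reads)).Config :=
  joinConfig (left w) (fun p => Equiv.swap (x₀ p.1.2) (left (left w) p.1.2) (right w p))

open scoped Classical in
/-- The configuration read off from the copies available at `t`. -/
def readCopies {S T : QSystem V} {reads : T.Site → List S.Site} (x₀ : S.Config)
    (c : (copies reads).Config) (t : T.Site) : S.Config :=
  fun s => if h : s ∈ reads t then c ⟨(t, s), h⟩ else x₀ s

theorem readCopies_congr {S T : QSystem V} {reads : T.Site → List S.Site} (x₀ : S.Config)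
    {c c' : (copies reads).Config} {t : T.Site}
    (h : ∀ s (hs : s ∈ reads t), c ⟨(t, s), hs⟩ = c' ⟨(t, s), hs⟩) :
    readCopies x₀ c t = readCopies x₀ c' t := by
  funext s
  by_cases hs : s ∈ reads t
  · have e : readCopies x₀ c t s = c ⟨(t, s), hs⟩ := dif_pos hs
    have e' : readCopies x₀ c' t s = c' ⟨(t, s), hs⟩ := dif_pos hs
    rw [e, e', h]
  · have e : readCopies x₀ c t s = x₀ s := dif_neg hs
    have e' : readCopies x₀ c' t s = x₀ s := dif_neg hs
    rw [e, e']

open scoped Classical in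
/-- The permutation that writes the values of `f`, computed from the copies. -/
def writePerm {S T : QSystem V} (f : S.Config → T.Config) (reads : T.Site → List S.Site)
    (x₀ : S.Config) (y₀ : T.Config)
    (w : ((S.join T).join (copies reads)).Config) : ((S.join T).join (copies reads)).Config :=
  joinConfig (joinConfig (left (left w)) (fun t => Equiv.swap (y₀ t)
    (f (readCopies x₀ (right w) t) t) (right (left w) t))) (right w)

end QSystem

open QSystem

variable {V : Type} {Γ : SimpleGraph V}

namespace Prep

-- Different outputs may read the same qudit, so the controlled permutation is not itself one layer
-- of disjoint gates. Each input is first copied to its readers, each output is then computed from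
-- its own copies, and the copies are finally cleared by repeating the copy layer. The five
-- operations are the ancillas, three layers and the measurement of the blank copies. Transpositions
-- make all steps involutive without any group structure on the bases.
open scoped Classical in
theorem of_ctrlSwap {R K r M k n : ℕ} {S T U : QSystem V} {φ : U.State} {f : S.Config → T.Config}
    (hf : IsLocalMap Γ r M f) (hr : 2 * r ≤ R)
    (hT : ∀ v, Nat.card {t : T.Site // T.loc t = v} ≤ k)
    (hX : ∀ s, Nat.card (S.X s) ≤ K) (hK : k * M ≤ K) (x₀ : S.Config) (y₀ : T.Config)
    {Ψ : (S.join T).State} (h : Prep Γ R K φ n (fun w => Ψ (ctrlSwap f y₀ w))) :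
    Prep Γ R K φ (n + 5) Ψ := by
  obtain ⟨reads, hM, hd, hloc⟩ := hf
  let W := (S.join T).join (copies reads)
  let c₀ : (copies reads).Config := fun p => x₀ p.1.2
  have hR : ∀ a b c : V, Γ.edist a b ≤ r → Γ.edist a c ≤ r → Γ.edist b c ≤ R := by
    intro a b c hab hac
    calc Γ.edist b c ≤ Γ.edist b a + Γ.edist a c := SimpleGraph.edist_triangle
      _ ≤ r + r := add_le_add (by rwa [SimpleGraph.edist_comm]) hac
      _ = ((2 * r : ℕ) : ℕ∞) := by push_cast; ring
      _ ≤ R := by exact_mod_cast hr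
  have h0 : ∀ a b : V, a = b → Γ.edist a b ≤ r := by
    rintro a b rfl
    simp
  -- For copying, a qudit is grouped with all its copies. They lie within `r` of it, so the block
  -- has diameter at most `2 * r`.
  let b₁ : W.Site → S.Site ⊕ T.Site := fun u => match u with
    | .inl (.inl s) => .inl s
    | .inl (.inr t) => .inr t
    | .inr p => .inl p.1.2
  -- For writing, an output is grouped with the copies it reads, which sit at its own location.
  let b₂ : W.Site → S.Site ⊕ T.Site := fun u => match u with
    | .inl (.inl s) => .inl s
    | .inl (.inr t) => .inr t
    | .inr p => .inr p.1.1
  have hp : ∀ p : (copies reads).Site, Γ.edist (T.loc p.1.1) (S.loc p.1.2) ≤ r :=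
    fun p => hd _ _ p.2
  have hp' : ∀ p : (copies reads).Site, Γ.edist (S.loc p.1.2) (T.loc p.1.1) ≤ r :=
    fun p => by rw [SimpleGraph.edist_comm]; exact hp p
  obtain ⟨L₁, hL₁⟩ : ∃ L : Layer Γ R W, ∀ ψ x, L.apply ψ x = ψ (copyPerm reads x₀ x) := by
    refine Layer.exists_apply_of_involutive (joinConfig (joinConfig x₀ y₀) c₀) b₁ ?_ _ ?_ ?_
    · rintro ((s | t) | p) ((s' | t') | p') hb <;> simp only [b₁, Sum.inl.injEq, Sum.inr.injEq, reduceCtorEq] at hb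
      · exact hR _ _ _ (h0 _ _ rfl) (h0 _ _ (by rw [hb]))
      · refine hR (S.loc s) _ _ (h0 _ _ rfl) ?_
        rw [hb]; exact hp' p'
      · exact hR _ _ _ (h0 _ _ rfl) (h0 _ _ (by rw [hb]))
      · refine hR (S.loc s') _ _ ?_ (h0 _ _ rfl)
        rw [← hb]; exact hp' p
      · refine hR (S.loc p.1.2) _ _ (hp' p) ?_
        rw [hb]; exact hp' p'
    · intro x
      funext u
      rcases u with u | p
      · rfl
      · exact Equiv.swap_apply_self _ _ _
    · rintro x y ((s | t) | p) hxy
      · exact hxy _ rfl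
      · exact hxy _ rfl
      · change Equiv.swap (x₀ p.1.2) (x (.inl (.inl p.1.2))) (x (.inr p)) =
          Equiv.swap (x₀ p.1.2) (y (.inl (.inl p.1.2))) (y (.inr p))
        rw [hxy (.inl (.inl p.1.2)) rfl, hxy (.inr p) rfl]
  obtain ⟨L₂, hL₂⟩ : ∃ L : Layer Γ R W, ∀ ψ x, L.apply ψ x = ψ (writePerm f reads x₀ y₀ x) := by
    refine Layer.exists_apply_of_involutive (joinConfig (joinConfig x₀ y₀) c₀) b₂ ?_ _ ?_ ?_
    · rintro ((s | t) | p) ((s' | t') | p') hb <;> simp only [b₂, Sum.inl.injEq, Sum.inr.injEq, reduceCtorEq] at hb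
      · exact hR _ _ _ (h0 _ _ rfl) (h0 _ _ (by rw [hb]))
      · exact hR _ _ _ (h0 _ _ rfl) (h0 _ _ (by rw [hb]))
      · exact hR _ _ _ (h0 _ _ rfl) (h0 (T.loc t) (T.loc p'.1.1) (by rw [hb]))
      · exact hR _ _ _ (h0 _ _ rfl) (h0 (T.loc p.1.1) (T.loc t') (by rw [hb]))
      · exact hR _ _ _ (h0 _ _ rfl) (h0 (T.loc p.1.1) (T.loc p'.1.1) (by rw [hb]))
    · intro x
      funext u
      rcases u with (s | t) | p
      · rfl
      · exact Equiv.swap_apply_self _ _ _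
      · rfl
    · rintro x y ((s | t) | p) hxy
      · exact hxy _ rfl
      · change Equiv.swap (y₀ t) (f (readCopies x₀ (right x) t) t) (right (left x) t) =
          Equiv.swap (y₀ t) (f (readCopies x₀ (right y) t) t) (right (left y) t)
        rw [readCopies_congr x₀ (c := right x) (c' := right y)
          fun s hs => hxy (.inr ⟨(t, s), hs⟩) rfl]
        exact congrArg _ (hxy (.inl (.inr t)) rfl)
      · exact hxy _ rfl
  refine .ancilla Ψ (copies reads) (copies_boundedBy hM hT hX hK) c₀ (.unitary _ L₁ (.unitary _ L₂
    (.unitary _ L₁ (.measure _ fun a ha => ?_))))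
  have key : postMeasurement (L₁.apply (L₂.apply (L₁.apply (addAncilla Ψ c₀)))) a =
      if a = c₀ then (fun w => Ψ (ctrlSwap f y₀ w)) else 0 := by
    funext w
    change L₁.apply (L₂.apply (L₁.apply (addAncilla Ψ c₀))) (joinConfig w a) = _
    rw [hL₁, hL₂, hL₁]
    by_cases hac : a = c₀
    · subst hac
      have h1 : copyPerm reads x₀ (joinConfig w c₀) =
          joinConfig w (fun p : (copies reads).Site => left w p.1.2) := by
        funext u
        rcases u with u | p
        · rfl
        · exact Equiv.swap_apply_left _ _
      have h2 : writePerm f reads x₀ y₀ (joinConfig w (fun p : (copies reads).Site => left w p.1.2)) =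
          joinConfig (ctrlSwap f y₀ w) (fun p : (copies reads).Site => left w p.1.2) := by
        funext u
        rcases u with (s | t) | p
        · rfl
        · change Equiv.swap (y₀ t) (f (readCopies x₀ (fun p : (copies reads).Site => left w p.1.2) t) t)
            (right w t) = Equiv.swap (y₀ t) (f (left w) t) (right w t)
          congr 2
          refine hloc _ _ _ fun s hs => ?_
          exact dif_pos hs
        · rfl
      have h3 : copyPerm reads x₀ (joinConfig (ctrlSwap f y₀ w) (fun p : (copies reads).Site => left w p.1.2)) =
          joinConfig (ctrlSwap f y₀ w) c₀ := by
        funext u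
        rcases u with u | p
        · rfl
        · exact Equiv.swap_apply_right _ _
      rw [h1, h2, h3, if_pos rfl, addAncilla_apply]
      exact guarded_pos rfl _
    -- The copies return to the blank state, so any other outcome has amplitude zero.
    · rw [if_neg hac, addAncilla_apply]
      refine guarded_neg (fun h => hac ?_) _
      rw [← h]
      funext p
      exact (Equiv.swap_apply_self (x₀ p.1.2) (left w p.1.2) (a p)).symm
  rw [key] at ha ⊢
  split_ifs at ha ⊢ with hac
  · exact h
  · exact absurd rfl ha

/-- Local functions of the configuration can be written to new qudits. -/
theorem of_compute {R K r M k n : ℕ} {S T U : QSystem V} {φ : U.State} {f : S.Config → T.Config}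
    (hf : IsLocalMap Γ r M f) (hr : 2 * r ≤ R) (hT : T.BoundedBy k) (hkK : k ≤ K)
    (hX : ∀ s, Nat.card (S.X s) ≤ K) (hK : k * M ≤ K) (x₀ : S.Config)
    {ψ : S.State} (h : Prep Γ R K φ n (S := S.join T)
      (fun w => guarded (right w = f (left w)) (ψ (left w)))) :
    Prep Γ R K φ (n + 6) ψ := by
  classical
  -- Any blank value would do; `f x₀` is one that is known to exist.
  refine .ancilla ψ T (hT.mono hkK) (f x₀) (of_ctrlSwap hf hr hT.1 hX hK x₀ (f x₀) ?_)
  convert h using 2 with w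
  rw [addAncilla_apply]
  refine guarded_congr (funext_iff.trans ((forall_congr' fun t => ?_).trans funext_iff.symm)) _
  change Equiv.swap (f x₀ t) (f (left w) t) (right w t) = f x₀ t ↔ _
  rw [← Equiv.eq_symm_apply, Equiv.symm_swap, Equiv.swap_apply_left]

/-- Qudits that contain a local function of the other ones can be removed. -/
theorem of_uncompute {R K r M k n : ℕ} {S T U : QSystem V} {φ : U.State} {f : S.Config → T.Config}
    (hf : IsLocalMap Γ r M f) (hr : 2 * r ≤ R)
    (hT : ∀ v, Nat.card {t : T.Site // T.loc t = v} ≤ k)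
    (hX : ∀ s, Nat.card (S.X s) ≤ K) (hK : k * M ≤ K) (x₀ : S.Config)
    {ψ : S.State} (h : Prep Γ R K φ n ψ) :
    Prep Γ R K φ (n + 6) (S := S.join T)
      (fun w => guarded (right w = f (left w)) (ψ (left w))) := by
  classical
  refine of_ctrlSwap (n := n + 1) hf hr hT hX hK x₀ (f x₀) (.measure _ fun a ha => ?_)
  have key : postMeasurement (S := S) (A := T) (fun w => guarded (right (ctrlSwap f (f x₀) w) =
      f (left (ctrlSwap f (f x₀) w))) (ψ (left (ctrlSwap f (f x₀) w)))) a =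
      fun x => guarded (a = f x₀) (ψ x) := by
    funext x
    refine guarded_congr (funext_iff.trans ((forall_congr' fun t => ?_).trans funext_iff.symm)) _
    change Equiv.swap (f x₀ t) (f x t) (a t) = f x t ↔ _
    rw [← Equiv.eq_symm_apply, Equiv.symm_swap, Equiv.swap_apply_right]
  rw [key] at ha ⊢
  by_cases hac : a = f x₀
  · simpa only [guarded_pos hac] using h
  · exact absurd (funext fun x => guarded_neg hac _) ha

end Prep

end

/-! ### On-site unitaries, character measurements and composite protocol steps. -/

section

namespace QSystem

variable {V : Type}

/-- Exchange of the two parts of a joint system. -/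
def joinComm (S T : QSystem V) : (S.join T).Iso (T.join S) where
  site := Equiv.sumComm S.Site T.Site
  basis := fun u => match u with
    | .inl _ => Equiv.refl _
    | .inr _ => Equiv.refl _
  loc_site := fun u => by cases u <;> rfl

theorem joinComm_map {S T : QSystem V} (Ψ : (S.join T).State) (w : (T.join S).Config) :
    (joinComm S T).map Ψ w = Ψ (joinConfig (right w) (left w)) := by
  refine congrArg Ψ ?_
  funext u
  cases u <;> rfl

/-- Joint configurations are pairs of configurations. -/
def joinConfigEquiv (S T : QSystem V) : (S.join T).Config ≃ S.Config × T.Config where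
  toFun w := (left w, right w)
  invFun p := joinConfig p.1 p.2
  left_inv := joinConfig_left_right
  right_inv _ := rfl

open scoped Classical in
theorem sum_join {S T : QSystem V} (g : (S.join T).Config → ℂ) :
    ∑ w, g w = ∑ x : S.Config, ∑ b : T.Config, g (joinConfig x b) := by
  rw [← (joinConfigEquiv S T).symm.sum_comp, Fintype.sum_prod_type]
  rfl

theorem prod_join {S T : QSystem V} (g : (S.join T).Site → ℂ) :
    ∏ u, g u = (∏ s : S.Site, g (.inl s)) * ∏ t : T.Site, g (.inr t) :=
  Fintype.prod_sum_type _

open scoped Classical in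
/-- Unitaries on the qudits of the second part of a joint system form one layer. -/
theorem Layer.exists_apply_of_right (Γ : SimpleGraph V) (R : ℕ) {S T : QSystem V}
    (U : ∀ t, Matrix (T.X t) (T.X t) ℂ) (hU : ∀ t, U t ∈ Matrix.unitaryGroup (T.X t) ℂ) :
    ∃ L : Layer Γ R (S.join T), ∀ Ψ w, L.apply Ψ w =
      ∑ b : T.Config, (∏ t, U t (right w t) (b t)) * Ψ (joinConfig (left w) b) := by
  let U' : ∀ u, Matrix ((S.join T).X u) ((S.join T).X u) ℂ := fun u => match u with
    | .inl s => (1 : Matrix (S.X s) (S.X s) ℂ)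
    | .inr t => U t
  have hU' : ∀ u, U' u ∈ Matrix.unitaryGroup ((S.join T).X u) ℂ := by
    rintro (s | t)
    · exact one_mem (Matrix.unitaryGroup (S.X s) ℂ)
    · exact hU t
  obtain ⟨L, hL⟩ := Layer.exists_apply_of_site Γ R U' hU'
  refine ⟨L, fun Ψ w => ?_⟩
  rw [hL, sum_join, Finset.sum_comm]
  refine Finset.sum_congr rfl fun b _ => ?_
  rw [Finset.sum_eq_single (left w)]
  · rw [prod_join]
    refine congrArg (· * _) ((congrArg (· * _) (Finset.prod_eq_one fun s _ => ?_)).trans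
      (one_mul _))
    exact Matrix.one_apply_eq (α := ℂ) (left w s)
  · intro x _ hx
    obtain ⟨s, hs⟩ := Function.ne_iff.1 hx
    rw [prod_join, Finset.prod_eq_zero (Finset.mem_univ s), zero_mul, zero_mul]
    exact Matrix.one_apply_ne (α := ℂ) hs.symm
  · exact fun h => absurd (Finset.mem_univ _) h

open scoped Classical in
/-- Any non-zero vector is proportional to a given column of some unitary matrix. -/
theorem exists_unitary_column {X : Type} [Fintype X] (b₀ : X) {χ : X → ℂ} (hχ : χ ≠ 0) :
    ∃ U ∈ Matrix.unitaryGroup X ℂ, ∃ c : ℂ, c ≠ 0 ∧ ∀ x, U x b₀ = c * χ x := by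
  let v : EuclideanSpace ℂ X := WithLp.toLp 2 χ
  have hv : v ≠ 0 := fun h => hχ (by simpa [v] using h)
  have hv' : ‖v‖ ≠ 0 := norm_ne_zero_iff.2 hv
  have ho : Orthonormal ℂ (Set.domRestrict ({b₀} : Set X) fun _ => ((‖v‖ : ℂ)⁻¹ • v)) := by
    constructor
    · rintro ⟨i, hi⟩
      simp [norm_smul, hv']
    · rintro ⟨i, rfl⟩ ⟨j, rfl⟩ hij
      exact absurd rfl hij
  obtain ⟨b, hb⟩ := ho.exists_orthonormalBasis_extension_of_card_eq (by simp)
  refine ⟨Matrix.of fun x y => b y x, ?_, (‖v‖ : ℂ)⁻¹, by simpa using hv', fun x => ?_⟩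
  · rw [Matrix.mem_unitaryGroup_iff']
    ext y z
    have := orthonormal_iff_ite.1 b.orthonormal y z
    rw [PiLp.inner_apply] at this
    simp only [Matrix.mul_apply, Matrix.star_apply, Matrix.of_apply, Matrix.one_apply]
    rw [← this]
    exact Finset.sum_congr rfl fun x _ => by simp [mul_comm]
  · simp only [Matrix.of_apply]
    rw [hb b₀ rfl]
    simp [v]

theorem norm_character {A : Type} [Group A] [Finite A] (χ : A →* ℂˣ) (a : A) :
    ‖(χ a : ℂ)‖ = 1 := by
  have h1 : (χ a : ℂ) ^ Nat.card A = 1 := by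
    rw [← Units.val_pow_eq_pow_val, ← map_pow, pow_card_eq_one', map_one, Units.val_one]
  exact Complex.norm_eq_one_of_pow_eq_one h1 Nat.card_pos.ne'

open scoped Classical in
/-- The Fourier transform of a finite abelian group. -/
theorem exists_fourier_matrix (A : Type) [CommGroup A] [Fintype A] :
    ∃ U ∈ Matrix.unitaryGroup A ℂ, ∃ c : ℂ, c ≠ 0 ∧
      ∀ a, ∃ χ : A →* ℂˣ, ∀ b, U a b = c * (χ b : ℂ) := by
  obtain ⟨e⟩ := CommGroup.monoidHom_mulEquiv_of_hasEnoughRootsOfUnity A ℂ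
  let c : ℂ := ((Real.sqrt (Fintype.card A) : ℝ) : ℂ)⁻¹
  have hcard : (Fintype.card A : ℂ) ≠ 0 := by simp
  have hc2 : c * c = (Fintype.card A : ℂ)⁻¹ := by
    rw [← mul_inv, ← Complex.ofReal_mul, Real.mul_self_sqrt (Nat.cast_nonneg _)]
    simp
  have hc0 : c ≠ 0 := by
    intro h
    rw [h, zero_mul] at hc2
    exact inv_ne_zero hcard hc2.symm
  have hstar : ∀ (χ : A →* ℂˣ) (a : A), star (χ a : ℂ) = ((χ a)⁻¹ : ℂˣ) := by
    intro χ a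
    rw [Units.val_inv_eq_inv_val, Complex.inv_def, Complex.normSq_eq_norm_sq, norm_character]
    simp
  refine ⟨Matrix.of fun a b => c * (e.symm a b : ℂ), ?_, c, hc0, fun a => ⟨e.symm a, fun b => rfl⟩⟩
  rw [Matrix.mem_unitaryGroup_iff]
  ext a a'
  have hcs : star c = c := by simp [c]
  simp only [Matrix.mul_apply, Matrix.star_apply, Matrix.of_apply, star_mul', hcs, hstar]
  have h : ∀ b, c * (e.symm a b : ℂ) * (c * ((e.symm a' b)⁻¹ : ℂˣ)) =
      (Fintype.card A : ℂ)⁻¹ * ((Units.coeHom ℂ).comp (e.symm a / e.symm a')) b := by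
    intro b
    rw [← hc2]
    simp [div_eq_mul_inv]
    ring
  simp only [h]
  rw [← Finset.mul_sum, Matrix.one_apply, sum_hom_units]
  have hiff : (Units.coeHom ℂ).comp (e.symm a / e.symm a') = 1 ↔ a = a' := by
    rw [← e.symm.injective.eq_iff, ← div_eq_one (a := e.symm a)]
    constructor
    · intro h
      ext b
      exact DFunLike.congr_fun h b
    · intro h
      rw [h]
      rfl
  by_cases haa : a = a'
  · rw [if_pos (hiff.2 haa), if_pos haa]
    exact inv_mul_cancel₀ hcard
  · rw [if_neg (mt hiff.1 haa), if_neg haa]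
    simp

end QSystem

open QSystem

variable {V : Type} {Γ : SimpleGraph V}

namespace Prep

/-- A local reversible change of variables. -/
theorem of_replace {R K r M k n : ℕ} {S T U : QSystem V} {φ : U.State} {f : S.Config → T.Config}
    {g : T.Config → S.Config} (hf : IsLocalMap Γ r M f) (hg : IsLocalMap Γ r M g)
    (hr : 2 * r ≤ R) (hS : S.BoundedBy k) (hT : T.BoundedBy k) (hkK : k ≤ K) (hK : k * M ≤ K)
    (x₀ : S.Config) {ψ : S.State} (hψ : ∀ x, ψ x ≠ 0 → g (f x) = x)
    (h : Prep Γ R K φ n (fun y => guarded (f (g y) = y) (ψ (g y)))) :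
    Prep Γ R K φ (n + 12) ψ := by
  -- Once `f x` is written next to `x`, the old variable equals `g` of the new one on the support of
  -- the state, so it can be uncomputed.
  refine of_compute (n := n + 6) hf hr hT hkK (fun s => (hS.2 s).trans hkK) hK x₀
    (.rename _ (joinComm S T) ?_)
  convert of_uncompute hg hr hS.1 (fun t => (hT.2 t).trans hkK) hK (f x₀) h using 1
  funext w
  rw [joinComm_map]
  simp only [right_joinConfig, left_joinConfig]
  by_cases h1 : right w = g (left w)
  · rw [guarded_pos h1, h1]
    exact guarded_congr eq_comm _
  · rw [guarded_neg h1]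
    by_contra h2
    obtain ⟨h2, h3⟩ := guarded_ne_zero.1 h2
    exact h1 (by rw [h2, hψ _ h3])

/-- Measurement of a local function of the configuration. -/
theorem of_measureFun {R K r M k n : ℕ} {S T U : QSystem V} {φ : U.State} {f : S.Config → T.Config}
    (hf : IsLocalMap Γ r M f) (hr : 2 * r ≤ R) (hT : T.BoundedBy k) (hkK : k ≤ K)
    (hX : ∀ s, Nat.card (S.X s) ≤ K) (hK : k * M ≤ K) (x₀ : S.Config) {ψ : S.State}
    (h : ∀ a, (∃ x, f x = a ∧ ψ x ≠ 0) → Prep Γ R K φ n (fun x => guarded (f x = a) (ψ x))) :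
    Prep Γ R K φ (n + 7) ψ := by
  refine of_compute (n := n + 1) hf hr hT hkK hX hK x₀ (.measure _ fun a ha => ?_)
  have key : postMeasurement (S := S) (A := T)
      (fun w => guarded (right w = f (left w)) (ψ (left w))) a =
      fun x => guarded (f x = a) (ψ x) := by
    funext x
    exact guarded_congr eq_comm _
  rw [key] at ha ⊢
  refine h a ?_
  obtain ⟨x, hx⟩ := Function.ne_iff.1 ha
  exact ⟨x, guarded_ne_zero.1 hx⟩

/-- Local phase gates. -/
theorem of_phase {R K r M k n : ℕ} {S T U : QSystem V} {φ : U.State} {f : S.Config → T.Config}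
    (hf : IsLocalMap Γ r M f) (hr : 2 * r ≤ R) (hT : T.BoundedBy k) (hkK : k ≤ K)
    (hX : ∀ s, Nat.card (S.X s) ≤ K) (hK : k * M ≤ K) (x₀ : S.Config) {ψ : S.State}
    (μ : ∀ t, T.X t → ℂ) (hμ : ∀ t a, ‖μ t a‖ = 1)
    (h : Prep Γ R K φ n (fun x => (∏ t, μ t (f x t)) * ψ x)) :
    Prep Γ R K φ (n + 13) ψ := by
  classical
  obtain ⟨L, hL⟩ := Layer.exists_apply_of_right Γ R (S := S)
    (fun t => Matrix.diagonal (μ t)) (fun t => by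
      rw [Matrix.mem_unitaryGroup_iff, Matrix.star_eq_conjTranspose, Matrix.diagonal_conjTranspose,
        Matrix.diagonal_mul_diagonal, ← Matrix.diagonal_one]
      congr 1
      funext a
      simp [Complex.mul_conj, Complex.normSq_eq_norm_sq, hμ])
  refine of_compute (n := n + 7) hf hr hT hkK hX hK x₀ (.unitary _ L ?_)
  convert of_uncompute hf hr hT.1 hX hK x₀ h using 1
  funext w
  rw [hL, Finset.sum_eq_single (right w)]
  · simp only [left_joinConfig, right_joinConfig, Matrix.diagonal_apply_eq]
    rw [mul_guarded]
    by_cases h1 : right w = f (left w)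
    · rw [guarded_pos h1, guarded_pos h1, h1]
    · rw [guarded_neg h1, guarded_neg h1]
  · intro b _ hb
    obtain ⟨t, ht⟩ := Function.ne_iff.1 hb
    rw [Finset.prod_eq_zero (Finset.mem_univ t), zero_mul]
    exact Matrix.diagonal_apply_ne _ ht.symm
  · exact fun h => absurd (Finset.mem_univ _) h

/-- Addition of qudits in a product state. -/
theorem of_addProduct {R K n : ℕ} {S T U : QSystem V} {φ : U.State} (hT : T.BoundedBy K)
    (χ : ∀ t, T.X t → ℂ) (hχ : ∀ t, χ t ≠ 0) {ψ : S.State}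
    (h : Prep Γ R K φ n (S := S.join T) (fun w => (∏ t, χ t (right w t)) * ψ (left w))) :
    Prep Γ R K φ (n + 2) ψ := by
  classical
  have hne : ∀ t, Nonempty (T.X t) := fun t => by
    obtain ⟨a, -⟩ := Function.ne_iff.1 (hχ t)
    exact ⟨a⟩
  let b₀ : T.Config := fun t => (hne t).some
  choose U hU c hc hUc using fun t => exists_unitary_column (b₀ t) (hχ t)
  obtain ⟨L, hL⟩ := Layer.exists_apply_of_right Γ R (S := S) U hU
  refine .ancilla ψ T hT b₀ (.unitary _ L ?_)
  convert h.smul (∏ t, c t) (Finset.prod_ne_zero_iff.2 fun t _ => hc t) using 1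
  funext w
  rw [hL, Finset.sum_eq_single b₀]
  · rw [Pi.smul_apply, smul_eq_mul, ← mul_assoc, ← Finset.prod_mul_distrib, addAncilla_apply,
      guarded_pos (right_joinConfig _ _)]
    exact congrArg (· * _) (Finset.prod_congr rfl fun t _ => hUc t _)
  · intro b _ hb
    rw [addAncilla_apply, guarded_neg (by simpa using hb), mul_zero]
  · exact fun h => absurd (Finset.mem_univ _) h

open scoped Classical in
/-- Measurement of qudits labelled by abelian groups in the basis of characters. -/
theorem of_fourier {R K n : ℕ} {S T U : QSystem V} {φ : U.State} [∀ t, CommGroup (T.X t)]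
    {Ψ : (S.join T).State}
    (h : ∀ χ : ∀ t, T.X t →* ℂˣ,
      (∃ x, ∑ b : T.Config, (∏ t, (χ t (b t) : ℂ)) * Ψ (joinConfig x b) ≠ 0) →
      Prep Γ R K φ n (S := S)
        (fun x => ∑ b : T.Config, (∏ t, (χ t (b t) : ℂ)) * Ψ (joinConfig x b))) :
    Prep Γ R K φ (n + 2) Ψ := by
  choose U hU c hc hUc using fun t => exists_fourier_matrix (T.X t)
  obtain ⟨L, hL⟩ := Layer.exists_apply_of_right Γ R (S := S) U hU
  refine .unitary _ L (.measure _ fun a ha => ?_)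
  choose χ hχ using fun t => hUc t (a t)
  have key : postMeasurement (L.apply Ψ) a = (∏ t, c t) •
      fun x => ∑ b : T.Config, (∏ t, (χ t (b t) : ℂ)) * Ψ (joinConfig x b) := by
    funext x
    change L.apply Ψ (joinConfig x a) = _
    rw [hL, Pi.smul_apply, smul_eq_mul, Finset.mul_sum]
    refine Finset.sum_congr rfl fun b _ => ?_
    rw [← mul_assoc, ← Finset.prod_mul_distrib]
    congr 1
    exact Finset.prod_congr rfl fun t _ => hχ t _
  rw [key] at ha ⊢
  refine (h χ ?_).smul _ (Finset.prod_ne_zero_iff.2 fun t _ => hc t)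
  by_contra! h0
  exact ha (by rw [funext h0]; exact smul_zero _)

/-- Product states can be prepared from anything. -/
theorem of_isProduct {R K : ℕ} {S T : QSystem V} {φ : T.State} (hT : T.BoundedBy K)
    (hφ : IsProduct φ) (ψ : S.State) : Prep Γ R K φ 3 ψ := by
  obtain ⟨χ, hχ, hφ⟩ := hφ
  let O : QSystem V := { Site := Empty, X := Empty.elim, loc := Empty.elim, fintypeX := fun s => s.elim }
  let f : S.Iso (O.join S) :=
    { site := (Equiv.emptySum Empty S.Site).symm
      basis := fun s => Equiv.refl _
      loc_site := fun s => rfl }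
  let g : (O.join T).Iso T :=
    { site := Equiv.emptySum Empty T.Site
      basis := fun s => match s with
        | .inr t => Equiv.refl _
      loc_site := fun s => match s with
        | .inr t => rfl }
  -- All original qudits are measured away, leaving a non-zero scalar on the empty system `O`.
  refine .rename ψ f (.measure _ fun a ha => of_addProduct hT χ hχ (.rename _ g ?_))
  obtain ⟨x, hx⟩ := Function.ne_iff.1 ha
  refine .done _ _ (postMeasurement (f.map ψ) a x) hx ?_
  funext y
  rw [Pi.smul_apply, smul_eq_mul, hφ, mul_comm]
  change (∏ t, χ t (y t)) * postMeasurement (f.map ψ) a _ = _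
  congr 2
  funext s
  exact s.elim

end Prep

end

/-! ### Pure gauges, holonomy and ground states. -/

section

namespace SpaceLattice

variable {Λ : SpaceLattice}

theorem IsPath.append {u v w : Λ.V} {l l' : List (Λ.E × Bool)} (h : Λ.IsPath u l v)
    (h' : Λ.IsPath v l' w) : Λ.IsPath u (l ++ l') w := by
  induction l generalizing u with
  | nil => exact (show u = v from h) ▸ h'
  | cons d l ih => exact ⟨h.1, ih h.2⟩

theorem isPath_single (e : Λ.E) : Λ.IsPath (Λ.src e) [(e, true)] (Λ.tgt e) := ⟨rfl, rfl⟩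

theorem isPath_single_rev (e : Λ.E) : Λ.IsPath (Λ.tgt e) [(e, false)] (Λ.src e) := ⟨rfl, rfl⟩

theorem IsCellulation.exists_isPath (h : Λ.IsCellulation) (u v : Λ.V) : ∃ l, Λ.IsPath u l v := by
  obtain ⟨w⟩ := h.connected.preconnected u v
  induction w with
  | nil => exact ⟨[], rfl⟩
  | cons hadj _ ih =>
    obtain ⟨l, hl⟩ := ih
    rw [graph, SimpleGraph.fromRel_adj] at hadj
    obtain ⟨-, ⟨e, rfl, rfl⟩ | ⟨e, rfl, rfl⟩⟩ := hadj
    · exact ⟨_, (isPath_single e).append hl⟩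
    · exact ⟨_, (isPath_single_rev e).append hl⟩

theorem IsCellulation.eq_of_forall_edge (h : Λ.IsCellulation) {α : Type} {k : Λ.V → α}
    (hk : ∀ e, k (Λ.src e) = k (Λ.tgt e)) (u v : Λ.V) : k u = k v := by
  obtain ⟨w⟩ := h.connected.preconnected u v
  induction w with
  | nil => rfl
  | cons hadj _ ih =>
    rw [← ih]
    rw [graph, SimpleGraph.fromRel_adj] at hadj
    obtain ⟨-, ⟨e, rfl, rfl⟩ | ⟨e, rfl, rfl⟩⟩ := hadj
    · exact hk e
    · exact (hk e).symm

end SpaceLattice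

namespace QuantumDouble

open QSystem

variable {G : Type} [Group G] {Λ : SpaceLattice}

/-- The flat connection `e ↦ (g (src e))⁻¹ * g (tgt e)`. -/
def coboundary (g : Λ.V → G) : Λ.E → G := fun e => (g (Λ.src e))⁻¹ * g (Λ.tgt e)

/-- The connections that are gauge equivalent to the trivial one. -/
def IsPureGauge (x : Λ.E → G) : Prop := ∃ g : Λ.V → G, x = coboundary g

theorem isPureGauge_coboundary (g : Λ.V → G) : IsPureGauge (coboundary g) := ⟨g, rfl⟩

theorem coboundary_one : coboundary (1 : Λ.V → G) = 1 := by
  funext e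
  simp [coboundary]

theorem isPureGauge_one : IsPureGauge (1 : Λ.E → G) := ⟨1, coboundary_one.symm⟩

/-- Equality of the coboundaries says that `g v * (h v)⁻¹` agrees at the two ends of each edge, and
the graph is connected. -/
theorem coboundary_eq_coboundary_iff (hΛ : Λ.IsCellulation) {g h : Λ.V → G} :
    coboundary g = coboundary h ↔ ∃ c, ∀ v, g v = c * h v := by
  constructor
  · intro hgh
    have hk : ∀ u v, g u * (h u)⁻¹ = g v * (h v)⁻¹ := hΛ.eq_of_forall_edge fun e => by
      have : (g (Λ.src e))⁻¹ * g (Λ.tgt e) = (h (Λ.src e))⁻¹ * h (Λ.tgt e) := congrFun hgh e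
      rw [eq_mul_inv_iff_mul_eq, mul_assoc, ← this]
      group
    obtain ⟨v₀⟩ := hΛ.connected.nonempty
    exact ⟨g v₀ * (h v₀)⁻¹, fun v => by rw [hk v₀ v, inv_mul_cancel_right]⟩
  · rintro ⟨c, hc⟩
    funext e
    simp [coboundary, hc, mul_assoc]

theorem map_coboundary {H : Type} [Group H] (f : G →* H) (g : Λ.V → G) (e : Λ.E) :
    f (coboundary g e) = coboundary (fun v => f (g v)) e := by
  simp [coboundary]

/-! ### Holonomy -/

theorem holonomy_append (x : Λ.E → G) (l l' : List (Λ.E × Bool)) :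
    holonomy x (l ++ l') = holonomy x l * holonomy x l' := by
  simp [holonomy]

theorem holonomy_cons (x : Λ.E → G) (d : Λ.E × Bool) (l : List (Λ.E × Bool)) :
    holonomy x (d :: l) = (if d.2 then x d.1 else (x d.1)⁻¹) * holonomy x l := by
  simp [holonomy]

theorem holonomy_nil (x : Λ.E → G) : holonomy x [] = 1 := rfl

theorem holonomy_congr {x y : Λ.E → G} {l : List (Λ.E × Bool)} (h : ∀ d ∈ l, x d.1 = y d.1) :
    holonomy x l = holonomy y l := by
  unfold holonomy
  congr 1
  refine List.map_congr_left fun d hd => ?_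
  rw [h d hd]

/-- The product along the path telescopes. -/
theorem holonomy_coboundary (g : Λ.V → G) {u v : Λ.V} {l : List (Λ.E × Bool)}
    (h : Λ.IsPath u l v) : holonomy (coboundary g) l = (g u)⁻¹ * g v := by
  induction l generalizing u with
  | nil =>
    rw [show u = v from h, holonomy_nil, inv_mul_cancel]
  | cons d l ih =>
    obtain ⟨rfl, h⟩ := h
    rw [holonomy_cons, ih h]
    obtain ⟨e, _ | _⟩ := d <;> simp [coboundary, SpaceLattice.start, SpaceLattice.finish, mul_assoc]

theorem map_holonomy {H : Type} [Group H] (f : G →* H) (x : Λ.E → G) (l : List (Λ.E × Bool)) :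
    f (holonomy x l) = holonomy (fun e => f (x e)) l := by
  induction l with
  | nil => simp [holonomy_nil]
  | cons d l ih =>
    rw [holonomy_cons, holonomy_cons, map_mul, ih]
    split_ifs <;> simp

theorem holonomy_mul_central {Z : Type} [CommGroup Z] {j : Z →* G} (hj : ∀ z g, j z * g = g * j z)
    (x : Λ.E → G) (z : Λ.E → Z) (l : List (Λ.E × Bool)) :
    holonomy (fun e => x e * j (z e)) l = holonomy x l * j (holonomy z l) := by
  induction l with
  | nil => simp [holonomy_nil]
  | cons d l ih =>
    rw [holonomy_cons, holonomy_cons, holonomy_cons, ih, map_mul]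
    split_ifs
    · rw [mul_assoc, mul_assoc, ← mul_assoc (j _) (holonomy x l), hj, mul_assoc]
    · rw [mul_inv_rev, map_inv, ← map_inv, hj, mul_assoc, mul_assoc,
        ← mul_assoc (j _) (holonomy x l), hj, mul_assoc]

theorem IsPureGauge.holonomy_bdry (hΛ : Λ.IsCellulation) {x : Λ.E → G} (hx : IsPureGauge x)
    (p : Λ.P) : holonomy x (Λ.bdry p) = 1 := by
  obtain ⟨g, rfl⟩ := hx
  obtain ⟨v, hv⟩ := hΛ.bdry_closed p
  rw [holonomy_coboundary g hv, inv_mul_cancel]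

/-- Flat connections on simply connected lattices are pure gauges. -/
theorem isPureGauge_iff (hΛ : Λ.IsCellulation) (hs : Λ.SimplyConnected) {x : Λ.E → G} :
    IsPureGauge x ↔ ∀ p, holonomy x (Λ.bdry p) = 1 := by
  refine ⟨fun h => h.holonomy_bdry hΛ, fun hx => ?_⟩
  have hstep : ∀ (v : Λ.V) (l l' : List (Λ.E × Bool)), Λ.HomotopyStep v v l l' →
      holonomy x l = holonomy x l' := by
    rintro v _ _ (⟨l₁, l₂, e, b, h⟩ | ⟨l₁, l₂, p, h, h'⟩)
    · cases b <;> simp [holonomy_append, holonomy_cons]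
    · simp [holonomy_append, hx p]
  have hclosed : ∀ (v : Λ.V) (l : List (Λ.E × Bool)), Λ.IsPath v l v → holonomy x l = 1 := by
    intro v l hl
    suffices ∀ l l', Relation.EqvGen (Λ.HomotopyStep v v) l l' → holonomy x l = holonomy x l' from
      this _ _ (hs v l hl)
    intro l l' h
    induction h with
    | rel _ _ h => exact hstep _ _ _ h
    | refl _ => rfl
    | symm _ _ _ ih => exact ih.symm
    | trans _ _ _ _ _ ih ih' => exact ih.trans ih'
  obtain ⟨v₀⟩ := hΛ.connected.nonempty
  choose path hpath using hΛ.exists_isPath v₀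
  refine ⟨fun v => holonomy x (path v), funext fun e => ?_⟩
  -- One return path closes both the route to the target through `e` and the chosen route to the
  -- target. Both loops have trivial holonomy, so the two routes agree.
  obtain ⟨l, hl⟩ := hΛ.exists_isPath (Λ.tgt e) v₀
  have h1 := hclosed v₀ _ ((hpath (Λ.src e)).append ((SpaceLattice.isPath_single e).append hl))
  have h2 := hclosed v₀ _ ((hpath (Λ.tgt e)).append hl)
  rw [holonomy_append, holonomy_append, ← mul_assoc] at h1
  rw [holonomy_append, ← h1] at h2
  have h3 := mul_right_cancel h2
  rw [coboundary, h3, inv_mul_cancel_left]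
  simp [holonomy]

/-! ### Gauge transformations -/

theorem gaugeAt_gaugeAt (v : Λ.V) (g h : G) (x : Λ.E → G) :
    gaugeAt v g (gaugeAt v h x) = gaugeAt v (g * h) x := by
  funext e
  unfold gaugeAt
  split_ifs <;> simp [mul_assoc]

theorem gaugeAt_one (v : Λ.V) (x : Λ.E → G) : gaugeAt v 1 x = x := by
  funext e
  simp [gaugeAt]

open scoped Classical in
theorem gaugeAt_coboundary (v : Λ.V) (g : G) (h : Λ.V → G) :
    gaugeAt v g (coboundary h) = coboundary fun u => h u * if u = v then g⁻¹ else 1 := by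
  funext e
  unfold gaugeAt coboundary
  by_cases h1 : Λ.src e = v <;> by_cases h2 : Λ.tgt e = v <;> simp [h1, h2, mul_assoc]

theorem isPureGauge_gaugeAt (v : Λ.V) (g : G) (x : Λ.E → G) :
    IsPureGauge (gaugeAt v g x) ↔ IsPureGauge x := by
  classical
  have h : ∀ (g : G) (x : Λ.E → G), IsPureGauge x → IsPureGauge (gaugeAt v g x) := by
    rintro g _ ⟨k, rfl⟩
    rw [gaugeAt_coboundary]
    exact isPureGauge_coboundary _
  refine ⟨fun hx => ?_, h g x⟩
  have := h g⁻¹ _ hx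
  rwa [gaugeAt_gaugeAt, inv_mul_cancel, gaugeAt_one] at this

/-! ### The quantum double state -/

variable [Fintype G]

variable (G Λ) in
/-- The uniform superposition of the pure gauges. -/
def pureState : (sys G Λ).State := fun x : Λ.E → G => guarded (IsPureGauge x) 1

/-- All pure gauges have the same number of potentials: pointwise right multiplication by `h`
carries the potentials of the trivial labelling to those of `coboundary h`. -/
theorem gs_eq (hΛ : Λ.IsCellulation) : ∃ c : ℂ, c ≠ 0 ∧ gs G Λ = c • pureState G Λ := by
  classical
  obtain ⟨v₀⟩ := hΛ.connected.nonempty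
  let a : ℂ := ∏ _v : Λ.V, ((Real.sqrt (Fintype.card G) : ℝ) : ℂ)⁻¹
  have ha : a ≠ 0 := by
    refine Finset.prod_ne_zero_iff.2 fun v _ => inv_ne_zero ?_
    rw [Complex.ofReal_ne_zero]
    exact (Real.sqrt_pos.2 (by exact_mod_cast Fintype.card_pos)).ne'
  let m : ℂ := ∑ k : Λ.V → G, if (1 : Λ.E → G) = coboundary k then a else 0
  have hm : m ≠ 0 := by
    have : m = (Finset.univ.filter fun k : Λ.V → G => (1 : Λ.E → G) = coboundary k).card * a := by
      simp [m, Finset.sum_ite]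
    rw [this]
    refine mul_ne_zero ?_ ha
    rw [Nat.cast_ne_zero]
    exact Finset.card_ne_zero.2 ⟨1, by simp [coboundary_one]⟩
  refine ⟨m, hm, funext fun x : Λ.E → G => ?_⟩
  have hgs : gs G Λ x = ∑ g : Λ.V → G, if x = coboundary g then a else 0 := by
    unfold gs KW
    exact Finset.sum_congr rfl fun g _ => if_congr Iff.rfl rfl rfl
  rw [hgs]
  change _ = m * guarded (IsPureGauge x) 1
  by_cases hx : IsPureGauge x
  · rw [guarded_pos hx, mul_one]
    obtain ⟨h, rfl⟩ := hx
    rw [← Equiv.sum_comp (Equiv.mulRight h)]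
    refine Finset.sum_congr rfl fun k _ => if_congr ?_ rfl rfl
    rw [← coboundary_one, coboundary_eq_coboundary_iff hΛ, coboundary_eq_coboundary_iff hΛ]
    refine exists_congr fun c => forall_congr' fun v => ?_
    simp only [Equiv.coe_mulRight, Pi.mul_apply, Pi.one_apply, ← mul_assoc]
    rw [right_eq_mul, eq_comm]
  · rw [guarded_neg hx, mul_zero]
    exact Finset.sum_eq_zero fun g _ => if_neg fun h => hx ⟨g, h⟩

theorem isGroundState_gs (hΛ : Λ.IsCellulation) : IsGroundState (gs G Λ) := by
  obtain ⟨c, hc, hgs⟩ := gs_eq (G := G) hΛ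
  rw [hgs]
  refine ⟨fun h => ?_, fun v => ?_, fun p => ?_⟩
  · have h1 : c * guarded (IsPureGauge (1 : Λ.E → G)) 1 = 0 := congrFun h (1 : Λ.E → G)
    rw [guarded_pos isPureGauge_one, mul_one] at h1
    exact hc h1
  · refine funext fun x : Λ.E → G => ?_
    change (Fintype.card G : ℂ)⁻¹ * ∑ g : G, c * guarded (IsPureGauge (gaugeAt v g⁻¹ x)) 1 =
      c * guarded (IsPureGauge x) 1
    simp only [isPureGauge_gaugeAt]
    rw [Finset.sum_const, nsmul_eq_mul, Finset.card_univ, inv_mul_cancel_left₀]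
    simp
  · funext x
    by_cases hx : holonomy (G := G) x (Λ.bdry p) = 1
    · exact if_pos hx
    · refine (if_neg hx).trans ?_
      change 0 = c * guarded (IsPureGauge x) 1
      rw [guarded_neg fun h => hx (h.holonomy_bdry hΛ p), mul_zero]

/-- A vector fixed by the average over a group is invariant under the group, by reindexing the sum.
-/
theorem IsGroundState.apply_gaugeAt {ψ : (sys G Λ).State} (hψ : IsGroundState ψ) (v : Λ.V) (h : G)
    (x : Λ.E → G) : ψ (gaugeAt v h x) = ψ x := by
  have key : ∀ x : Λ.E → G, ψ x = (Fintype.card G : ℂ)⁻¹ * ∑ g : G, ψ (gaugeAt v g⁻¹ x) :=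
    fun x => (congrFun (hψ.vertex v) x).symm
  rw [key (gaugeAt v h x), key x]
  congr 1
  rw [← Equiv.sum_comp (Equiv.mulLeft h)]
  refine Finset.sum_congr rfl fun g _ => ?_
  rw [gaugeAt_gaugeAt, Equiv.coe_mulLeft, mul_inv_rev, inv_mul_cancel_right]

/-- Gauge transformations reset the potential to the identity one vertex at a time; the induction is
on a finite set containing its support. -/
theorem IsGroundState.apply_coboundary {ψ : (sys G Λ).State} (hψ : IsGroundState ψ)
    (g : Λ.V → G) : ψ (coboundary g) = ψ (1 : Λ.E → G) := by
  classical
  suffices ∀ (s : Finset Λ.V) (g : Λ.V → G), (∀ v ∉ s, g v = 1) →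
      ψ (coboundary g) = ψ (1 : Λ.E → G) from
    this Finset.univ g fun v hv => absurd (Finset.mem_univ v) hv
  intro s
  induction s using Finset.induction_on with
  | empty =>
    intro g hg
    rw [show g = 1 from funext fun v => hg v (Finset.notMem_empty v), coboundary_one]
  | insert v s _ ih =>
    intro g hg
    rw [← hψ.apply_gaugeAt v (g v), gaugeAt_coboundary]
    refine ih _ fun u hu => ?_
    by_cases huv : u = v
    · simp [huv]
    · simp [huv, hg u (by simp [huv, hu])]

/-- On a simply connected lattice the ground state is unique. -/
theorem IsGroundState.eq_smul_gs (hΛ : Λ.IsCellulation) (hs : Λ.SimplyConnected)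
    {ψ : (sys G Λ).State} (hψ : IsGroundState ψ) : ∃ c : ℂ, ψ = c • gs G Λ := by
  obtain ⟨c, hc, hgs⟩ := gs_eq (G := G) hΛ
  refine ⟨ψ (1 : Λ.E → G) * c⁻¹, funext fun x : Λ.E → G => ?_⟩
  rw [hgs]
  change ψ x = ψ (1 : Λ.E → G) * c⁻¹ * (c * guarded (IsPureGauge x) 1)
  rw [← mul_assoc, inv_mul_cancel_right₀ hc]
  by_cases hx : IsPureGauge x
  · rw [guarded_pos hx, mul_one]
    obtain ⟨g, hg⟩ := hx
    rw [hg]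
    exact hψ.apply_coboundary g
  · rw [guarded_neg hx, mul_zero]
    rw [isPureGauge_iff hΛ hs, not_forall] at hx
    obtain ⟨p, hp⟩ := hx
    exact (congrFun (hψ.plaquette p) x).symm.trans (if_neg hp)

end QuantumDouble

end

/-! ### Characters, uniform systems and lattice locality bounds. -/

section

/-- A character that is trivial on the kernel of a homomorphism factors through it. -/
theorem exists_character_eq_comp {A B : Type} [CommGroup A] [CommGroup B] [Finite B] (δ : A →* B)
    (χ : A →* ℂˣ) (h : ∀ a, δ a = 1 → χ a = 1) : ∃ η : B →* ℂˣ, ∀ a, χ a = η (δ a) := by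
  let χ' : δ.range →* ℂˣ :=
    δ.rangeRestrict.liftOfSurjective δ.rangeRestrict_surjective ⟨χ, fun a ha => h a (by
      simpa [MonoidHom.ker_rangeRestrict] using ha)⟩
  -- The character obtained on the image of `δ` extends to all of `B`; this is where `B` being
  -- finite abelian enters.
  obtain ⟨η, hη⟩ := MonoidHom.domRestrict_surjective ℂ δ.range χ'
  refine ⟨η, fun a => ?_⟩
  have h1 : χ' (δ.rangeRestrict a) = χ a :=
    MonoidHom.liftOfRightInverse_comp_apply _ _ _ _ a
  rw [← h1, ← hη]
  rfl

theorem character_pi_eq_prod {I A : Type} [Fintype I] [DecidableEq I] [CommGroup A]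
    (η : (I → A) →* ℂˣ) (x : I → A) : η x = ∏ i, η (Pi.mulSingle i (x i)) := by
  rw [← map_prod, Finset.univ_prod_mulSingle]

namespace QSystem

variable {V : Type} {Γ : SimpleGraph V}

/-- One `A`-qudit at the location of each element of `I`. -/
def uniformSys {I : Type} [Fintype I] (A : Type) [Fintype A] (loc : I → V) : QSystem V where
  Site := I
  X := fun _ => A
  loc := loc

theorem uniformSys_boundedBy {I A : Type} [Fintype I] [Fintype A] {loc : I → V} {k : ℕ}
    (hI : ∀ v, Nat.card {i // loc i = v} ≤ k) (hA : Nat.card A ≤ k) :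
    (uniformSys A loc).BoundedBy k :=
  ⟨hI, fun _ => hA⟩

theorem join_boundedBy {S T : QSystem V} {k l : ℕ} (hS : S.BoundedBy k) (hT : T.BoundedBy l) :
    (S.join T).BoundedBy (k + l) := by
  refine ⟨fun v => ?_, fun u => ?_⟩
  · let g : {u : (S.join T).Site // (S.join T).loc u = v} →
        {s : S.Site // S.loc s = v} ⊕ {t : T.Site // T.loc t = v} := fun u => match u with
      | ⟨.inl s, h⟩ => .inl ⟨s, h⟩
      | ⟨.inr t, h⟩ => .inr ⟨t, h⟩
    have hg : Function.Injective g := by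
      rintro ⟨s | t, h⟩ ⟨s' | t', h'⟩ hgg
      · cases hgg; rfl
      · cases hgg
      · cases hgg
      · cases hgg; rfl
    refine (Nat.card_le_card_of_injective g hg).trans ?_
    rw [Nat.card_sum]
    exact add_le_add (hS.1 v) (hT.1 v)
  · rcases u with s | t
    · exact (hS.2 s).trans (Nat.le_add_right _ _)
    · exact (hT.2 t).trans (Nat.le_add_left _ _)

theorem isLocalMap_uniform {I J A A' : Type} [Fintype I] [Fintype J] [Fintype A] [Fintype A']
    {loc : I → V} {loc' : J → V} {r M : ℕ} (f : (I → A) → J → A') (reads : J → List I)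
    (hM : ∀ j, (reads j).length ≤ M) (hr : ∀ j, ∀ i ∈ reads j, Γ.edist (loc' j) (loc i) ≤ r)
    (hf : ∀ j x y, (∀ i ∈ reads j, x i = y i) → f x j = f y j) :
    IsLocalMap Γ r M (S := uniformSys A loc) (T := uniformSys A' loc') f :=
  ⟨reads, hM, hr, hf⟩

theorem isLocalMap_join_uniform {I I' J A A' B : Type} [Fintype I] [Fintype I'] [Fintype J]
    [Fintype A] [Fintype A'] [Fintype B] {loc : I → V} {loc₂ : I' → V} {loc' : J → V} {r M : ℕ}
    (f : (I → A) → (I' → A') → J → B) (reads : J → List I) (reads' : J → List I')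
    (hM : ∀ j, (reads j).length + (reads' j).length ≤ M)
    (hr : ∀ j, ∀ i ∈ reads j, Γ.edist (loc' j) (loc i) ≤ r)
    (hr' : ∀ j, ∀ i ∈ reads' j, Γ.edist (loc' j) (loc₂ i) ≤ r)
    (hf : ∀ j x y x' y', (∀ i ∈ reads j, x i = y i) → (∀ i ∈ reads' j, x' i = y' i) →
      f x x' j = f y y' j) :
    IsLocalMap Γ r M (S := (uniformSys A loc).join (uniformSys A' loc₂)) (T := uniformSys B loc')
      fun w => f (left w) (right w) := by
  refine ⟨fun j => ((reads j).map Sum.inl ++ (reads' j).map Sum.inr : List (I ⊕ I')),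
    fun j => ?_, fun j u hu => ?_, fun j w z h => ?_⟩
  · have : ((reads j).map Sum.inl ++ (reads' j).map Sum.inr : List (I ⊕ I')).length ≤ M := by
      simpa using hM j
    exact this
  · rcases List.mem_append.1 hu with h | h
    · obtain ⟨i, hi, rfl⟩ := List.mem_map.1 h
      exact hr j i hi
    · obtain ⟨i, hi, rfl⟩ := List.mem_map.1 h
      exact hr' j i hi
  · exact hf j _ _ _ _
      (fun i hi => h (.inl i) (List.mem_append_left _ (List.mem_map_of_mem hi)))
      fun i hi => h (.inr i) (List.mem_append_right _ (List.mem_map_of_mem hi))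

theorem IsLocalMap.join {S T T' : QSystem V} {r M : ℕ} {f : S.Config → T.Config}
    {g : S.Config → T'.Config} (hf : IsLocalMap Γ r M f) (hg : IsLocalMap Γ r M g) :
    IsLocalMap Γ r M (T := T.join T') fun x => joinConfig (f x) (g x) := by
  obtain ⟨a, ha, ha', ha''⟩ := hf
  obtain ⟨b, hb, hb', hb''⟩ := hg
  refine ⟨Sum.elim a b, ?_, ?_, ?_⟩
  · rintro (t | t)
    exacts [ha t, hb t]
  · rintro (t | t)
    exacts [ha' t, hb' t]
  · rintro (t | t) x y h
    exacts [ha'' t x y h, hb'' t x y h]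

theorem guarded_guarded (p q : Prop) (z : ℂ) : guarded p (guarded q z) = guarded (p ∧ q) z := by
  by_cases hp : p <;> by_cases hq : q <;> simp [guarded, hp, hq]

end QSystem

open QSystem

namespace Prep

variable {V : Type} {Γ : SimpleGraph V} {R K n : ℕ} {S U : QSystem V} {φ : U.State}

theorem of_addUniform {I A : Type} [Fintype I] [Fintype A] {loc : I → V} [Nonempty A]
    (hT : (uniformSys A loc).BoundedBy K) {ψ : S.State}
    (h : Prep Γ R K φ n (S := S.join (uniformSys A loc)) (fun w => ψ (left w))) :
    Prep Γ R K φ (n + 2) ψ := by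
  refine of_addProduct hT (fun _ _ => 1) (fun _ h0 => ?_) ?_
  · exact one_ne_zero (congrFun h0 (Classical.arbitrary A))
  · simpa using h

-- The characters measured at the sites multiply to one character of the product group, the form in
-- which fibre sums can be evaluated.
open scoped Classical in
theorem of_fourier_uniform {I A : Type} [Fintype I] [CommGroup A] [Fintype A] {loc : I → V}
    {Ψ : (S.join (uniformSys A loc)).State}
    (h : ∀ χ : (I → A) →* ℂˣ, (∃ x : S.Config, ∑ b : I → A,
        (χ b : ℂ) * Ψ (joinConfig (A := uniformSys A loc) x b) ≠ 0) →
      Prep Γ R K φ n (S := S) (fun x => ∑ b : I → A,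
        (χ b : ℂ) * Ψ (joinConfig (A := uniformSys A loc) x b))) :
    Prep Γ R K φ (n + 2) Ψ := by
  let _ : ∀ i, CommGroup ((uniformSys A loc).X i) := fun _ => ‹CommGroup A›
  refine of_fourier (T := uniformSys A loc) fun χ hχ => ?_
  obtain ⟨ξ, hξ⟩ : ∃ ξ : I → (A →* ℂˣ), ∀ (i : I) (a : A), ξ i a = χ i a :=
    ⟨χ, fun _ _ => rfl⟩
  let χ' : (I → A) →* ℂˣ :=
    { toFun := fun b => ∏ i, ξ i (b i)
      map_one' := by simp
      map_mul' := fun a b => by simp [Finset.prod_mul_distrib] }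
  have hχ' : ∀ b : I → A, (χ' b : ℂ) = ∏ i : I, (ξ i (b i) : ℂ) := fun b => by
    simp [χ']
  have key : ∀ x : S.Config, ∑ b : I → A, (χ' b : ℂ) * Ψ (joinConfig (A := uniformSys A loc) x b) =
      ∑ b : (uniformSys A loc).Config, (∏ t, (χ t (b t) : ℂ)) * Ψ (joinConfig x b) := fun x =>
    Fintype.sum_equiv (Equiv.refl _) _ _ fun b => by
      rw [hχ']
      exact congrArg (· * _) (Finset.prod_congr rfl fun i _ => congrArg Units.val (hξ i (b i)))
  have := h χ' (by simpa only [key] using hχ)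
  simpa only [key] using this

/-- Although `η` may come from a global computation, a character of a product group is a product of
characters of the factors, so its phase is applied site by site. -/
theorem of_phase_uniform {r M k : ℕ} {I A : Type} [Fintype I] [CommGroup A] [Fintype A]
    {loc : I → V} {f : S.Config → (uniformSys A loc).Config}
    (hf : IsLocalMap Γ r M f) (hr : 2 * r ≤ R) (hT : (uniformSys A loc).BoundedBy k) (hkK : k ≤ K)
    (hX : ∀ s, Nat.card (S.X s) ≤ K) (hK : k * M ≤ K) (x₀ : S.Config) {ψ : S.State}
    (η : (I → A) →* ℂˣ) (h : Prep Γ R K φ n (fun x => (η (f x) : ℂ) * ψ x)) :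
    Prep Γ R K φ (n + 13) ψ := by
  classical
  refine of_phase hf hr hT hkK hX hK x₀ (fun i a => (η (Pi.mulSingle (M := fun _ => A) i a) : ℂ))
    (fun i a => norm_character _ _) ?_
  convert h using 3 with x
  have h1 := congrArg Units.val (character_pi_eq_prod η (f x))
  rw [Units.coe_prod] at h1
  exact h1.symm

end Prep

namespace SpaceLattice

variable {Λ : SpaceLattice}

theorem edist_src_tgt_le (e : Λ.E) : Λ.graph.edist (Λ.src e) (Λ.tgt e) ≤ 1 := by
  rw [SimpleGraph.edist_le_one_iff_adj_or_eq]
  by_cases h : Λ.src e = Λ.tgt e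
  · exact .inr h
  · exact .inl ⟨h, .inl ⟨e, rfl, rfl⟩⟩

theorem edist_start_finish_le (d : Λ.E × Bool) :
    Λ.graph.edist (Λ.start d) (Λ.finish d) ≤ 1 := by
  obtain ⟨e, _ | _⟩ := d
  · rw [SimpleGraph.edist_comm]
    exact edist_src_tgt_le e
  · exact edist_src_tgt_le e

theorem edist_start_src_le (d : Λ.E × Bool) : Λ.graph.edist (Λ.start d) (Λ.src d.1) ≤ 1 := by
  obtain ⟨e, _ | _⟩ := d
  · rw [SimpleGraph.edist_comm]
    exact edist_src_tgt_le e
  · simp [start]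

theorem IsPath.edist_le {u v : Λ.V} {l : List (Λ.E × Bool)} (h : Λ.IsPath u l v)
    {d : Λ.E × Bool} (hd : d ∈ l) : Λ.graph.edist u (Λ.src d.1) ≤ l.length := by
  induction l generalizing u with
  | nil => simp at hd
  | cons d' l ih =>
    obtain ⟨rfl, h⟩ := h
    rcases List.mem_cons.1 hd with rfl | hd
    · refine (edist_start_src_le d).trans ?_
      simp
    · refine SimpleGraph.edist_triangle.trans
        ((add_le_add (edist_start_finish_le d') (ih h hd)).trans ?_)
      rw [List.length_cons, add_comm]
      push_cast
      exact le_rfl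

theorem BoundedBy.card_src_le {D : ℕ} (hD : Λ.BoundedBy D) (v : Λ.V) :
    Nat.card {e // Λ.src e = v} ≤ D :=
  (Nat.card_le_card_of_injective
    (fun e : {e // Λ.src e = v} => (⟨e.1, .inl e.2⟩ : {e // Λ.src e = v ∨ Λ.tgt e = v}))
    fun _ _ h => Subtype.ext (congrArg (fun x => x.1) h)).trans (hD.degree v)

/-- Plaquette qudits need a location of bounded occupancy. The first boundary edge of a plaquette
touches its base, and a vertex has at most `D` edges with at most `D` plaquettes each. -/
theorem IsCellulation.exists_base (hΛ : Λ.IsCellulation) {D : ℕ} (hD : Λ.BoundedBy D) :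
    ∃ base : Λ.P → Λ.V, (∀ p, Λ.IsPath (base p) (Λ.bdry p) (base p)) ∧
      ∀ v, Nat.card {p // base p = v} ≤ D * D := by
  classical
  choose base hbase using hΛ.bdry_closed
  refine ⟨base, hbase, fun v => ?_⟩
  have hhead : ∀ p, ∃ d ∈ Λ.bdry p, Λ.start d = base p := by
    intro p
    have h1 := hbase p
    have h2 := hΛ.bdry_ne_nil p
    cases hb : Λ.bdry p with
    | nil => exact absurd hb h2
    | cons d l =>
      rw [hb] at h1
      exact ⟨d, List.mem_cons_self, h1.1⟩
  choose d hd hd' using hhead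
  have hsv : ∀ d : Λ.E × Bool, Λ.start d = v → Λ.src d.1 = v ∨ Λ.tgt d.1 = v := by
    rintro ⟨e, _ | _⟩ h
    · exact .inr h
    · exact .inl h
  let g : {p // base p = v} → Σ e : {e // Λ.src e = v ∨ Λ.tgt e = v},
      {p : Λ.P // ∃ b, (e.1, b) ∈ Λ.bdry p} := fun p =>
    ⟨⟨(d p.1).1, hsv _ ((hd' p.1).trans p.2)⟩, ⟨p.1, (d p.1).2, hd p.1⟩⟩
  have hg : Function.Injective g := by
    rintro ⟨p, hp⟩ ⟨p', hp'⟩ h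
    exact Subtype.ext (congrArg (fun x => x.2.1) h)
  refine (Nat.card_le_card_of_injective g hg).trans ?_
  rw [Nat.card_sigma]
  refine (Finset.sum_le_card_nsmul _ _ D fun e _ => hD.codegree e.1).trans ?_
  rw [smul_eq_mul, Finset.card_univ, ← Nat.card_eq_fintype_card]
  exact Nat.mul_le_mul_right _ (hD.degree v)

end SpaceLattice

end

/-! ### From a group to a normal subgroup. -/

section

namespace QuantumDouble

open QSystem

variable {Λ : SpaceLattice} {D B : ℕ}

/-- A bound on the number and the dimension of the qudits at a location, if there are
`B`-dimensional qudits on the edges, vertices and plaquettes. -/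
def density (D B : ℕ) : ℕ := D + D * D + 1 + B

/-- The number of ancillas needed for local operations on such systems. -/
def ancillaBound (D B : ℕ) : ℕ := (density D B + density D B) * (D + 3)

theorem density_le (D B : ℕ) : density D B ≤ density D B + density D B := Nat.le_add_left _ _

theorem two_density_le (D B : ℕ) : density D B + density D B ≤ ancillaBound D B :=
  Nat.le_mul_of_pos_right _ (by omega)

theorem density_mul_le (D B : ℕ) : density D B * (D + 3) ≤ ancillaBound D B :=
  Nat.mul_le_mul_right _ (density_le D B)

theorem density_le_ancillaBound (D B : ℕ) : density D B ≤ ancillaBound D B :=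
  (density_le D B).trans (two_density_le D B)

theorem le_density (D B : ℕ) : B ≤ density D B := Nat.le_add_left _ _

section Bounds

variable {A : Type} [Fintype A]

theorem sys_boundedBy (hD : Λ.BoundedBy D) (hA : Nat.card A ≤ B) :
    (sys A Λ).BoundedBy (density D B) :=
  ⟨fun v => (hD.card_src_le v).trans (by unfold density; omega),
    fun _ => hA.trans (le_density D B)⟩

theorem vertexSys_boundedBy (hA : Nat.card A ≤ B) :
    (uniformSys A fun v : Λ.V => v).BoundedBy (density D B) :=
  uniformSys_boundedBy (fun v => by
    rw [Nat.card_unique]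
    unfold density
    omega) (hA.trans (le_density D B))

theorem plaquetteSys_boundedBy {base : Λ.P → Λ.V} (hb : ∀ v, Nat.card {p // base p = v} ≤ D * D)
    (hA : Nat.card A ≤ B) : (uniformSys A base).BoundedBy (density D B) :=
  uniformSys_boundedBy (fun v => (hb v).trans (by unfold density; omega))
    (hA.trans (le_density D B))

end Bounds

/-- The constants are generous here because all later maps share them: `D + 3` covers an edge with
its two ends as well as the at most `D` edges of a plaquette, and `D + 1` covers the corresponding
distances. -/
theorem isLocalMap_edgewise {A A' : Type} [Fintype A] [Fintype A'] (f : Λ.E → A → A') :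
    IsLocalMap (S := sys A Λ) (T := sys A' Λ) Λ.graph (D + 1) (D + 3)
      (fun (x : Λ.E → A) e => f e (x e)) := by
  refine isLocalMap_uniform (loc := Λ.src) (loc' := Λ.src) (fun (x : Λ.E → A) e => f e (x e))
    (fun e => [e]) (fun e => ?_) (fun e e' he => ?_) fun e x y h => ?_
  · rw [List.length_singleton]
    omega
  · rw [List.mem_singleton.1 he, SimpleGraph.edist_self]
    exact zero_le
  · rw [h e (List.mem_singleton_self e)]

/-- The quantum double state of a normal subgroup can be prepared from that of the group. -/
theorem prep_of_exact {N G Q : Type} [Group N] [Group G] [Group Q] [Fintype N] [Fintype G]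
    [Fintype Q] (ι : N →* G) (π : G →* Q) (hι : Function.Injective ι)
    (hπ : ∀ g, π g = 1 ↔ ∃ n, ι n = g) (hΛ : Λ.IsCellulation) (hD : Λ.BoundedBy D)
    (hN : Nat.card N ≤ B) (hG : Nat.card G ≤ B) (hQ : Nat.card Q ≤ B) :
    Prep Λ.graph (2 * (D + 1)) (ancillaBound D B) (pureState N Λ) 19 (pureState G Λ) := by
  obtain ⟨ρ, hρ⟩ := hι.hasLeftInverse
  refine Prep.of_measureFun (n := 12) (isLocalMap_edgewise fun _ => π) le_rfl
    (sys_boundedBy hD hQ) (density_le_ancillaBound D B)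
    (fun _ => hG.trans ((le_density D B).trans (density_le_ancillaBound D B)))
    (density_mul_le D B) (1 : Λ.E → G) fun q hq => ?_
  obtain ⟨x₀, rfl, hx₀⟩ := hq
  -- A possible outcome comes from some pure gauge. Its potential `h` is global classical data, but
  -- the correction it defines acts edge by edge.
  obtain ⟨⟨h, rfl⟩, -⟩ := guarded_ne_zero.1 hx₀
  let f : (Λ.E → G) → (Λ.E → N) := fun x e =>
    ρ (h (Λ.src e) * x e * (h (Λ.tgt e))⁻¹)
  let g : (Λ.E → N) → (Λ.E → G) := fun n e =>
    (h (Λ.src e))⁻¹ * ι (n e) * h (Λ.tgt e)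
  have hfg : ∀ n, f (g n) = n := by
    intro n
    funext e
    change ρ (h (Λ.src e) * ((h (Λ.src e))⁻¹ * ι (n e) * h (Λ.tgt e)) * (h (Λ.tgt e))⁻¹) = n e
    rw [mul_assoc (h _)⁻¹, mul_inv_cancel_left, mul_inv_cancel_right, hρ]
  refine Prep.of_replace (n := 0) (f := f) (g := g)
    (isLocalMap_edgewise fun e a => ρ (h (Λ.src e) * a * (h (Λ.tgt e))⁻¹))
    (isLocalMap_edgewise fun e n => (h (Λ.src e))⁻¹ * ι n * h (Λ.tgt e)) le_rfl
    (sys_boundedBy hD hG) (sys_boundedBy hD hN) (density_le_ancillaBound D B)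
    (density_mul_le D B) (1 : Λ.E → G) ?_ (.done _ _ 1 one_ne_zero ?_)
  · intro (x : Λ.E → G) hx
    obtain ⟨hx, -⟩ := guarded_ne_zero.1 hx
    funext e
    have hxe : π (x e) = π (coboundary h e) := congrFun hx e
    obtain ⟨n, hn⟩ := (hπ (h (Λ.src e) * x e * (h (Λ.tgt e))⁻¹)).1 (by
      rw [map_mul, map_mul, hxe, ← map_mul, ← map_mul, coboundary]
      simp)
    change (h (Λ.src e))⁻¹ * ι (ρ (h (Λ.src e) * x e * (h (Λ.tgt e))⁻¹)) * h (Λ.tgt e) = x e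
    rw [← hn, hρ, hn]
    group
  · have key : ∀ n : Λ.E → N, guarded (f (g n) = n) (guarded ((fun e => π (g n e)) =
        fun e => π (coboundary h e)) (guarded (IsPureGauge (g n)) 1)) =
        guarded (IsPureGauge n) 1 := ?_
    · rw [one_smul]
      exact funext key
    intro n
    rw [guarded_pos (hfg n), guarded_pos]
    · refine guarded_congr ?_ 1
      constructor
      · rintro ⟨a, ha⟩
        have ha' : ∀ e, (h (Λ.src e))⁻¹ * ι (n e) * h (Λ.tgt e) =
            (a (Λ.src e))⁻¹ * a (Λ.tgt e) := congrFun ha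
        have hιn : ∀ e, ι (n e) =
            (a (Λ.src e) * (h (Λ.src e))⁻¹)⁻¹ * (a (Λ.tgt e) * (h (Λ.tgt e))⁻¹) := by
          intro e
          rw [mul_inv_rev, inv_inv, mul_assoc, ← mul_assoc (a _)⁻¹, ← ha' e]
          group
        -- The potential of an `N`-valued pure gauge may take values in `G`, but its image in the
        -- quotient is constant. Dividing on the left by the value at `v₀` moves it into `N`.
        have hconst := hΛ.eq_of_forall_edge (k := fun v => π (a v * (h v)⁻¹)) fun e => by
          have h1 := (hπ (ι (n e))).2 ⟨_, rfl⟩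
          rw [hιn, map_mul, map_inv, inv_mul_eq_one] at h1
          exact h1
        obtain ⟨v₀⟩ := hΛ.connected.nonempty
        have hm : ∀ v, ∃ m, ι m = (a v₀ * (h v₀)⁻¹)⁻¹ * (a v * (h v)⁻¹) := fun v => by
          rw [← hπ, map_mul, map_inv, inv_mul_eq_one]
          exact hconst v₀ v
        choose m hm using hm
        refine ⟨m, funext fun e => hι ?_⟩
        rw [coboundary, map_mul, map_inv, hm, hm, hιn]
        group
      · rintro ⟨m, rfl⟩
        refine ⟨fun v => ι (m v) * h v, funext fun e => ?_⟩
        change (h (Λ.src e))⁻¹ * ι ((m (Λ.src e))⁻¹ * m (Λ.tgt e)) * h (Λ.tgt e) =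
          (ι (m (Λ.src e)) * h (Λ.src e))⁻¹ * (ι (m (Λ.tgt e)) * h (Λ.tgt e))
        simp [mul_assoc]
    · refine funext fun e => ?_
      change π ((h (Λ.src e))⁻¹ * ι (n e) * h (Λ.tgt e)) = π (coboundary h e)
      rw [map_mul, map_mul, (hπ (ι (n e))).2 ⟨_, rfl⟩, coboundary, map_mul, mul_one]

end QuantumDouble

end

/-! ### From a normal subgroup with abelian quotient to the group. -/

section

namespace QSystem

theorem sum_guarded {I : Type} (s : Finset I) (p : Prop) (f : I → ℂ) :
    ∑ i ∈ s, guarded p (f i) = guarded p (∑ i ∈ s, f i) := by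
  by_cases h : p <;> simp [guarded, h]

theorem sum_guarded_one_ne_zero {I : Type} [Fintype I] {p : I → Prop} (h : ∃ i, p i) :
    ∑ i, guarded (p i) 1 ≠ 0 := by
  classical
  have : ∑ i, guarded (p i) 1 = ((Finset.univ.filter p).card : ℂ) := by
    simp only [guarded]
    rw [Finset.sum_boole]
  rw [this, Nat.cast_ne_zero]
  obtain ⟨i, hi⟩ := h
  exact Finset.card_ne_zero.2 ⟨i, by simpa using hi⟩

/-- The sums of a character over the fibres of a homomorphism. -/
theorem exists_sum_fiber_eq {A B : Type} [CommGroup A] [CommGroup B] [Fintype A] [Finite B]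
    (δ : A →* B) (χ : A →* ℂˣ) (h : ∃ t, ∑ a, (χ a : ℂ) * guarded (δ a = t) 1 ≠ 0) :
    ∃ η : B →* ℂˣ, ∃ C : ℂ, C ≠ 0 ∧
      ∀ t, ∑ a, (χ a : ℂ) * guarded (δ a = t) 1 = η t * guarded (∃ a, δ a = t) C := by
  -- Translation by a kernel element preserves the fibre and multiplies the sum by its character
  -- value, which must be one if the sum is non-zero.
  have hker : ∀ a, δ a = 1 → χ a = 1 := by
    intro a ha
    obtain ⟨t, ht⟩ := h
    have h1 : ∑ b, (χ b : ℂ) * guarded (δ b = t) 1 =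
        χ a * ∑ b, (χ b : ℂ) * guarded (δ b = t) 1 := by
      conv_lhs => rw [← Equiv.sum_comp (Equiv.mulLeft a)]
      rw [Finset.mul_sum]
      refine Finset.sum_congr rfl fun b _ => ?_
      rw [Equiv.coe_mulLeft, map_mul, map_mul, ha, one_mul, Units.val_mul, mul_assoc]
    exact Units.ext (mul_right_cancel₀ ht (h1.symm.trans (one_mul _).symm))
  obtain ⟨η, hη⟩ := exists_character_eq_comp δ χ hker
  refine ⟨η, ∑ a, guarded (δ a = 1) 1, sum_guarded_one_ne_zero ⟨1, map_one δ⟩, fun t => ?_⟩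
  have h1 : ∀ a, (χ a : ℂ) * guarded (δ a = t) 1 = η t * guarded (δ a = t) 1 := by
    intro a
    by_cases hat : δ a = t
    · rw [hη, hat]
    · rw [guarded_neg hat, mul_zero, mul_zero]
  simp only [h1]
  rw [← Finset.mul_sum]
  congr 1
  by_cases ht : ∃ a, δ a = t
  · rw [guarded_pos ht]
    obtain ⟨a, rfl⟩ := ht
    -- Non-empty fibres are cosets of the kernel, so the constant is the same for all of them.
    rw [← Equiv.sum_comp (Equiv.mulRight a)]
    refine Finset.sum_congr rfl fun b _ => guarded_congr ?_ 1
    rw [Equiv.coe_mulRight, map_mul, mul_eq_right]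
  · rw [guarded_neg ht]
    exact Finset.sum_eq_zero fun a _ => guarded_neg (fun h => ht ⟨a, h⟩) 1

end QSystem

open QSystem

theorem Prep.of_eq {V : Type} {Γ : SimpleGraph V} {R K n : ℕ} {S U : QSystem V} {φ : U.State}
    {ψ ψ' : S.State} (h : ψ = ψ') (h' : Prep Γ R K φ n ψ') : Prep Γ R K φ n ψ :=
  h ▸ h'

namespace QuantumDouble

variable {Λ : SpaceLattice} {D B : ℕ}

variable (Λ) in
/-- The map `coboundary` for an abelian group. -/
def coboundaryHom (Q : Type) [CommGroup Q] : (Λ.V → Q) →* (Λ.E → Q) where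
  toFun := coboundary
  map_one' := coboundary_one
  map_mul' := fun q q' => funext fun e => by
    simp only [coboundary, Pi.mul_apply, mul_inv]
    exact mul_mul_mul_comm _ _ _ _

/-- If the `N`-labelling has potential `n`, then `y` has potential `ι (n v) * s (q v)`. Conversely,
`q` and the image of a potential `g` of `y` differ by a constant `c`, and the factor `s c` moves `g
v * (s (q v))⁻¹` into the kernel without changing coboundaries. After the change of variables, the
vertex qudits therefore depend on `y` only through its image in `Q`. -/
theorem isPureGauge_and_coboundary_iff {N G Q : Type} [Group N] [Group G] [CommGroup Q]
    {ι : N →* G} {π : G →* Q}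
    (hπ : ∀ g, π g = 1 ↔ ∃ n, ι n = g) (hΛ : Λ.IsCellulation) {ρ : G → N}
    (hρ : Function.LeftInverse ρ ι) {s : Q → G} (hs : Function.RightInverse s π)
    (y : Λ.E → G) (q : Λ.V → Q) :
    ((∀ e, (s (q (Λ.src e)))⁻¹ * ι (ρ (s (q (Λ.src e)) * y e * (s (q (Λ.tgt e)))⁻¹)) *
        s (q (Λ.tgt e)) = y e) ∧
      IsPureGauge fun e => ρ (s (q (Λ.src e)) * y e * (s (q (Λ.tgt e)))⁻¹)) ↔
    IsPureGauge y ∧ coboundary q = fun e => π (y e) := by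
  constructor
  · rintro ⟨h1, n, hn⟩
    have hn' : ∀ e, ρ (s (q (Λ.src e)) * y e * (s (q (Λ.tgt e)))⁻¹) =
        (n (Λ.src e))⁻¹ * n (Λ.tgt e) := congrFun hn
    have hy : y = coboundary fun v => ι (n v) * s (q v) := by
      funext e
      rw [← h1 e, hn', coboundary]
      simp [mul_assoc]
    refine ⟨⟨_, hy⟩, ?_⟩
    funext e
    rw [hy, map_coboundary]
    simp only [map_mul, (hπ (ι _)).2 ⟨_, rfl⟩, one_mul, hs _]
  · rintro ⟨⟨g, rfl⟩, hq⟩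
    have hq' : coboundary q = coboundary fun v => π (g v) := by
      rw [hq]
      exact funext fun e => map_coboundary π g e
    obtain ⟨c, hc⟩ := (coboundary_eq_coboundary_iff hΛ).1 hq'
    have hn : ∀ v, ∃ n, ι n = s c * g v * (s (q v))⁻¹ := fun v => by
      rw [← hπ, map_mul, map_mul, map_inv, hs, hs, hc, mul_inv_cancel]
    choose n hn using hn
    have hx : ∀ e, s (q (Λ.src e)) * coboundary g e * (s (q (Λ.tgt e)))⁻¹ =
        ι (coboundary n e) := fun e => by
      rw [map_coboundary, coboundary, coboundary, hn, hn]
      group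
    simp only [hx, hρ _]
    refine ⟨fun e => ?_, isPureGauge_coboundary n⟩
    rw [← hx]
    group

/-- The quantum double state of a group can be prepared from that of a normal subgroup with abelian
quotient. -/
theorem prep_of_exact_abelian {N G Q : Type} [Group N] [Group G] [CommGroup Q] [Fintype N]
    [Fintype G] [Fintype Q] (ι : N →* G) (π : G →* Q) (hι : Function.Injective ι)
    (hπs : Function.Surjective π) (hπ : ∀ g, π g = 1 ↔ ∃ n, ι n = g) (hΛ : Λ.IsCellulation)
    (hD : Λ.BoundedBy D) (hN : Nat.card N ≤ B) (hG : Nat.card G ≤ B) (hQ : Nat.card Q ≤ B) :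
    Prep Λ.graph (2 * (D + 1)) (ancillaBound D B) (pureState G Λ) 29 (pureState N Λ) := by
  classical
  obtain ⟨ρ, hρ⟩ := hι.hasLeftInverse
  obtain ⟨s, hs⟩ := hπs.hasRightInverse
  let T : QSystem Λ.V := uniformSys Q fun v : Λ.V => v
  have hT : T.BoundedBy (density D B) := vertexSys_boundedBy hQ
  let f₁ : (Λ.E → N) → (Λ.V → Q) → Λ.E → G := fun x q e =>
    (s (q (Λ.src e)))⁻¹ * ι (x e) * s (q (Λ.tgt e))
  let g₁ : (Λ.E → G) → (Λ.V → Q) → Λ.E → N := fun y q e =>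
    ρ (s (q (Λ.src e)) * y e * (s (q (Λ.tgt e)))⁻¹)
  have hgf : ∀ x q, g₁ (f₁ x q) q = x := by
    intro x q
    funext e
    change ρ (s (q (Λ.src e)) * ((s (q (Λ.src e)))⁻¹ * ι (x e) * s (q (Λ.tgt e))) *
      (s (q (Λ.tgt e)))⁻¹) = x e
    rw [mul_assoc (s _)⁻¹, mul_inv_cancel_left, mul_inv_cancel_right, hρ]
  let f : ((sys N Λ).join T).Config → ((sys G Λ).join T).Config := fun w =>
    joinConfig (S := sys G Λ) (A := T) (f₁ (left w) (right w)) (right w)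
  let g : ((sys G Λ).join T).Config → ((sys N Λ).join T).Config := fun w =>
    joinConfig (S := sys N Λ) (A := T) (g₁ (left w) (right w)) (right w)
  have hlocal : ∀ {A A' : Type} [Fintype A] [Fintype A']
      (k : Q → A → Q → A'), IsLocalMap (S := (sys A Λ).join T) (T := (sys A' Λ).join T) Λ.graph
        (D + 1) (D + 3) fun w => joinConfig (S := sys A' Λ) (A := T)
          ((fun (x : Λ.E → A) (q : Λ.V → Q) e => k (q (Λ.src e)) (x e) (q (Λ.tgt e)))
            (left w) (right w)) (right w) := by
    intro A A' _ _ k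
    refine IsLocalMap.join
      (isLocalMap_join_uniform (loc := Λ.src) (loc₂ := fun v => v) (loc' := Λ.src)
        (fun (x : Λ.E → A) (q : Λ.V → Q) e => k (q (Λ.src e)) (x e) (q (Λ.tgt e)))
        (fun e => [e]) (fun e => [Λ.src e, Λ.tgt e]) (fun e => ?_) (fun e e' he => ?_)
        (fun e v hv => ?_) (fun e x y q q' h h' => ?_))
      (isLocalMap_join_uniform (loc := Λ.src) (loc₂ := fun v => v) (loc' := fun v => v)
        (fun (x : Λ.E → A) (q : Λ.V → Q) => q)
        (fun v => []) (fun v => [v]) (fun v => ?_) (fun v e he => ?_)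
        (fun v v' hv => ?_) (fun v x y q q' h h' => ?_))
    · simp only [List.length_cons, List.length_nil]
      omega
    · rw [List.mem_singleton.1 he, SimpleGraph.edist_self]
      exact zero_le
    · simp only [List.mem_cons, List.not_mem_nil, or_false] at hv
      rcases hv with rfl | rfl
      · rw [SimpleGraph.edist_self]
        exact zero_le
      · refine (SpaceLattice.edist_src_tgt_le e).trans ?_
        simp
    · rw [h e (by simp), h' (Λ.src e) (by simp), h' (Λ.tgt e) (by simp)]
    · simp only [List.length_cons, List.length_nil]
      omega
    · simp at he
    · rw [List.mem_singleton.1 hv, SimpleGraph.edist_self]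
      exact zero_le
    · exact h' v (by simp)
  refine Prep.of_addUniform (n := 27) (loc := fun v : Λ.V => v)
    (hT.mono (density_le_ancillaBound D B)) ?_
  refine Prep.of_replace (n := 15) (S := (sys N Λ).join T) (T := (sys G Λ).join T) (f := f) (g := g)
    (hlocal fun q a q' => (s q)⁻¹ * ι a * s q')
    (hlocal fun q a q' => ρ (s q * a * (s q')⁻¹)) le_rfl
    (join_boundedBy (sys_boundedBy hD hN) hT) (join_boundedBy (sys_boundedBy hD hG) hT)
    (two_density_le D B) le_rfl
    (joinConfig (S := sys N Λ) (A := T) (1 : Λ.E → N) (1 : Λ.V → Q)) ?_ ?_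
  · intro w _
    rw [← joinConfig_left_right w]
    exact congrArg (fun x => joinConfig (S := sys N Λ) (A := T) x (right w))
      (hgf (left w) (right w))
  have key : ∀ (y : Λ.E → G) (q : Λ.V → Q), guarded (f (g (joinConfig (S := sys G Λ) (A := T) y q)) =
      joinConfig (S := sys G Λ) (A := T) y q) (guarded (IsPureGauge (g₁ y q)) 1) =
      guarded (IsPureGauge y) (guarded (coboundaryHom Λ Q q = fun e => π (y e)) 1) := by
    intro y q
    rw [guarded_guarded, guarded_guarded]
    refine guarded_congr ?_ 1
    refine (and_congr_left' ?_).trans (isPureGauge_and_coboundary_iff hπ hΛ hρ hs y q)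
    constructor
    · intro h e
      exact congrFun (congrArg left h) e
    · intro h
      exact congrArg (fun x => joinConfig (S := sys G Λ) (A := T) x q) (funext h)
  refine Prep.of_fourier_uniform (n := 13) (S := sys G Λ) (loc := fun v : Λ.V => v) fun χ hχ => ?_
  have key' : ∀ y : Λ.E → G, ∑ q : Λ.V → Q, (χ q : ℂ) * guarded (f (g (joinConfig (S := sys G Λ)
      (A := T) y q)) = joinConfig (S := sys G Λ) (A := T) y q) (guarded (IsPureGauge (g₁ y q)) 1) =
      guarded (IsPureGauge y)
        (∑ q : Λ.V → Q, (χ q : ℂ) * guarded (coboundaryHom Λ Q q = fun e => π (y e)) 1) := by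
    intro y
    simp only [key, mul_guarded, sum_guarded]
  obtain ⟨y₀, hy₀⟩ := hχ
  have hy₁ := guarded_ne_zero.1 ((key' y₀).symm.trans_ne hy₀)
  -- The measured vertex qudits leave the phase `η` of the edge labels `π (y e)`, undone below by
  -- applying `η⁻¹`.
  obtain ⟨η, C, hC, hη⟩ := exists_sum_fiber_eq (coboundaryHom Λ Q) χ ⟨_, hy₁.2⟩
  refine Prep.of_phase_uniform (n := 0) (f := fun (y : Λ.E → G) e => π (y e)) (loc := Λ.src)
    (isLocalMap_edgewise fun _ => π) le_rfl
    (sys_boundedBy hD hQ) (density_le_ancillaBound D B)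
    (fun _ => hG.trans ((le_density D B).trans (density_le_ancillaBound D B)))
    (density_mul_le D B) (1 : Λ.E → G) η⁻¹ (.done _ _ C hC ?_)
  have key₂ : ∀ y : Λ.E → G, ((η⁻¹ fun e => π (y e) : ℂˣ) : ℂ) * ∑ q : Λ.V → Q, (χ q : ℂ) *
      guarded (f (g (joinConfig (S := sys G Λ) (A := T) y q)) =
        joinConfig (S := sys G Λ) (A := T) y q) (guarded (IsPureGauge (g₁ y q)) 1) =
      C * guarded (IsPureGauge y) 1 := by
    intro y
    rw [key', hη, MonoidHom.inv_apply]
    by_cases hy : IsPureGauge y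
    · rw [guarded_pos hy, guarded_pos hy, guarded_pos, mul_one, ← mul_assoc, Units.inv_mul, one_mul]
      obtain ⟨a, rfl⟩ := hy
      exact ⟨fun v => π (a v), funext fun e => (map_coboundary π a e).symm⟩
    · rw [guarded_neg hy, guarded_neg hy, mul_zero, mul_zero]
  exact funext key₂

end QuantumDouble

end

/-! ### Central extensions on simply connected lattices. -/

section

open QSystem

namespace QuantumDouble

variable {Λ : SpaceLattice} {D B : ℕ}

variable (Λ) in
/-- The holonomies around the plaquettes, for an abelian group. -/
def holonomyHom (Z : Type) [CommGroup Z] : (Λ.E → Z) →* (Λ.P → Z) where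
  toFun z p := holonomy z (Λ.bdry p)
  map_one' := funext fun p => by simp [holonomy]
  map_mul' := fun z z' => funext fun p => by
    exact holonomy_mul_central (G := Z) (j := MonoidHom.id Z) (fun a b => mul_comm _ _) z z'
      (Λ.bdry p)

theorem isLocalMap_plaquette {A A' : Type} [Fintype A] [Fintype A'] {base : Λ.P → Λ.V}
    (hb : ∀ p, Λ.IsPath (base p) (Λ.bdry p) (base p)) (hD : Λ.BoundedBy D)
    (F : (Λ.E → A) → Λ.P → A')
    (hF : ∀ p x y, (∀ d ∈ Λ.bdry p, x d.1 = y d.1) → F x p = F y p) :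
    IsLocalMap (S := sys A Λ) (T := uniformSys A' base) Λ.graph (D + 1) (D + 3) F := by
  refine isLocalMap_uniform (loc := Λ.src) (loc' := base) F (fun p => (Λ.bdry p).map Prod.fst)
    (fun p => ?_) (fun p e he => ?_) fun p x y h => ?_
  · rw [List.length_map]
    exact (hD.length p).trans (by omega)
  · obtain ⟨d, hd, rfl⟩ := List.mem_map.1 he
    refine ((hb p).edist_le hd).trans ?_
    exact_mod_cast (hD.length p).trans (Nat.le_succ D)
  · exact hF p x y fun d hd => h d.1 (List.mem_map_of_mem hd)

section Split

variable {P K Z : Type} [Fintype P] [Fintype K] [Fintype Z]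

/-- The edgewise map `x ↦ (a x, b x)`. -/
def splitConfig (a : P → K) (b : P → Z) (x : (sys P Λ).Config) :
    ((sys K Λ).join (sys Z Λ)).Config :=
  joinConfig (S := sys K Λ) (A := sys Z Λ) ((fun (x : Λ.E → P) e => a (x e)) x)
    ((fun (x : Λ.E → P) e => b (x e)) x)

/-- The edgewise map `(k, z) ↦ m k z`. -/
def mergeConfig (m : K → Z → P) (w : ((sys K Λ).join (sys Z Λ)).Config) : (sys P Λ).Config :=
  (fun (k : Λ.E → K) (z : Λ.E → Z) e => m (k e) (z e)) (left w) (right w)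

theorem isLocalMap_splitConfig (a : P → K) (b : P → Z) :
    IsLocalMap Λ.graph (D + 1) (D + 3) (splitConfig (Λ := Λ) a b) :=
  (isLocalMap_edgewise fun _ => a).join (isLocalMap_edgewise fun _ => b)

theorem isLocalMap_mergeConfig (m : K → Z → P) :
    IsLocalMap Λ.graph (D + 1) (D + 3) (mergeConfig (Λ := Λ) m) := by
  refine isLocalMap_join_uniform (loc := Λ.src) (loc₂ := Λ.src) (loc' := Λ.src)
    (fun (k : Λ.E → K) (z : Λ.E → Z) e => m (k e) (z e)) (fun e => [e]) (fun e => [e])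
    (fun e => ?_) (fun e e' he => ?_) (fun e e' he => ?_) (fun e k k' z z' h h' => ?_)
  · simp only [List.length_cons, List.length_nil]
    omega
  · rw [List.mem_singleton.1 he, SimpleGraph.edist_self]
    exact zero_le
  · rw [List.mem_singleton.1 he, SimpleGraph.edist_self]
    exact zero_le
  · rw [h e (by simp), h' e (by simp)]

theorem mergeConfig_splitConfig {a : P → K} {b : P → Z} {m : K → Z → P}
    (h : ∀ x, m (a x) (b x) = x) (x : (sys P Λ).Config) :
    mergeConfig m (splitConfig a b x) = x :=
  (funext fun e => h ((fun (x : Λ.E → P) => x e) x) :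
    (fun e => m (a ((fun (x : Λ.E → P) => x e) x)) (b ((fun (x : Λ.E → P) => x e) x))) = x)

theorem splitConfig_mergeConfig {a : P → K} {b : P → Z} {m : K → Z → P}
    (ha : ∀ k z, a (m k z) = k) (hb : ∀ k z, b (m k z) = z)
    (w : ((sys K Λ).join (sys Z Λ)).Config) : splitConfig a b (mergeConfig m w) = w := by
  funext u
  rcases u with e | e
  · exact ha _ _
  · exact hb _ _

end Split

section Central

variable {P K Z : Type} [Group P] [Group K] [CommGroup Z] {j : Z →* P} {π : P →* K}
  {ρ : P → Z} {s : K → P}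

/-- A set-theoretic splitting of a central extension gives bijective coordinates. -/
theorem mul_splitting (hπ : ∀ g, π g = 1 ↔ ∃ z, j z = g) (hρ : Function.LeftInverse ρ j)
    (x : P) {g : P} (hg : π g = π x) : g * j (ρ (g⁻¹ * x)) = x := by
  obtain ⟨z, hz⟩ := (hπ (g⁻¹ * x)).1 (by rw [map_mul, map_inv, hg, inv_mul_cancel])
  rw [← hz, hρ, hz, mul_inv_cancel_left]

theorem isPureGauge_map {x : Λ.E → P} (hx : IsPureGauge x) (π : P →* K) :
    IsPureGauge fun e => π (x e) := by
  obtain ⟨g, rfl⟩ := hx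
  exact ⟨fun v => π (g v), funext (map_coboundary π g)⟩

theorem IsPureGauge.exists_lift {k : Λ.E → K} (hk : IsPureGauge k)
    (hs : Function.RightInverse s π) : ∃ t : Λ.V → P, ∀ e, π (coboundary t e) = k e := by
  obtain ⟨κ, rfl⟩ := hk
  refine ⟨fun v => s (κ v), fun e => ?_⟩
  rw [map_coboundary]
  simp only [hs _]

/-- Simple connectivity turns the pure gauge condition into one equation per plaquette. Central
factors leave the holonomy product, so each equation asks the flux of `z` to cancel a central flux
of `x`. -/
theorem isPureGauge_mul_iff (hjc : ∀ z g, j z * g = g * j z)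
    (hρ : Function.LeftInverse ρ j) (hΛ : Λ.IsCellulation) (hsc : Λ.SimplyConnected)
    (x : Λ.E → P) (z : Λ.E → Z) :
    IsPureGauge (fun e => x e * j (z e)) ↔ (∀ p, ∃ ζ, j ζ = holonomy x (Λ.bdry p)) ∧
      holonomyHom Λ Z z = fun p => (ρ (holonomy x (Λ.bdry p)))⁻¹ := by
  rw [isPureGauge_iff hΛ hsc]
  simp only [holonomy_mul_central hjc]
  constructor
  · intro h
    have h1 : ∀ p, j (holonomy z (Λ.bdry p))⁻¹ = holonomy x (Λ.bdry p) := fun p => by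
      rw [map_inv]
      exact (eq_inv_of_mul_eq_one_left (h p)).symm
    refine ⟨fun p => ⟨_, h1 p⟩, funext fun p => ?_⟩
    rw [← h1 p, hρ, inv_inv]
    rfl
  · rintro ⟨h1, h2⟩ p
    have h3 : holonomy z (Λ.bdry p) = (ρ (holonomy x (Λ.bdry p)))⁻¹ := congrFun h2 p
    obtain ⟨ζ, hζ⟩ := h1 p
    rw [h3, ← hζ, hρ, map_inv, mul_inv_cancel]

variable [Fintype P] [Fintype K] [Fintype Z]

/-- On simply connected lattices, the quantum double state of a central quotient can be prepared
from that of the group. -/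
theorem prep_quotient_of_central (hj : Function.Injective j) (hjc : ∀ z g, j z * g = g * j z)
    (hπs : Function.Surjective π) (hπ : ∀ g, π g = 1 ↔ ∃ z, j z = g) (hΛ : Λ.IsCellulation)
    (hsc : Λ.SimplyConnected) (hD : Λ.BoundedBy D) (hP : Nat.card P ≤ B) (hK : Nat.card K ≤ B)
    (hZ : Nat.card Z ≤ B) :
    Prep Λ.graph (2 * (D + 1)) (ancillaBound D B) (pureState K Λ) 27 (pureState P Λ) := by
  classical
  obtain ⟨ρ, hρ⟩ := hj.hasLeftInverse
  obtain ⟨s, hs⟩ := hπs.hasRightInverse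
  obtain ⟨base, hb, hb'⟩ := hΛ.exists_base hD
  have hsplit : ∀ x, s (π x) * j (ρ ((s (π x))⁻¹ * x)) = x := fun x =>
    mul_splitting hπ hρ x (hs _)
  have ha : ∀ k z, π (s k * j z) = k := fun k z => by
    rw [map_mul, hs, (hπ (j z)).2 ⟨z, rfl⟩, mul_one]
  have hb'' : ∀ k z, ρ ((s (π (s k * j z)))⁻¹ * (s k * j z)) = z := fun k z => by
    rw [ha, inv_mul_cancel_left, hρ]
  let τ : (Λ.E → K) → Λ.P → Z := fun k p => (ρ (holonomy (fun e => s (k e)) (Λ.bdry p)))⁻¹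
  let cond : (Λ.E → K) → Prop := fun k => ∀ p, ∃ ζ, j ζ = holonomy (fun e => s (k e)) (Λ.bdry p)
  let m : K → Z → P := fun k z => s k * j z
  let b : P → Z := fun x => ρ ((s (π x))⁻¹ * x)
  refine Prep.of_replace (n := 15) (isLocalMap_splitConfig π b) (isLocalMap_mergeConfig m) le_rfl
    ((sys_boundedBy hD hP).mono (density_le D B))
    (join_boundedBy (sys_boundedBy hD hK) (sys_boundedBy hD hZ)) (two_density_le D B) le_rfl
    (1 : Λ.E → P) (fun x _ => mergeConfig_splitConfig hsplit x) ?_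
  have key : ∀ (k : Λ.E → K) (z : Λ.E → Z),
      guarded (splitConfig π b (mergeConfig m (joinConfig (S := sys K Λ) (A := sys Z Λ) k z)) =
        joinConfig (S := sys K Λ) (A := sys Z Λ) k z)
        (guarded (IsPureGauge fun e => s (k e) * j (z e)) 1) =
      guarded (cond k) (guarded (holonomyHom Λ Z z = τ k) 1) := by
    intro k z
    rw [guarded_pos (splitConfig_mergeConfig ha hb'' _), guarded_guarded]
    exact guarded_congr (isPureGauge_mul_iff hjc hρ hΛ hsc _ z) 1
  refine Prep.of_fourier_uniform (n := 13) (S := sys K Λ) (loc := Λ.src) fun χ hχ => ?_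
  have key' : ∀ k : Λ.E → K, ∑ z : Λ.E → Z, (χ z : ℂ) *
      guarded (splitConfig π b (mergeConfig m (joinConfig (S := sys K Λ) (A := sys Z Λ) k z)) =
        joinConfig (S := sys K Λ) (A := sys Z Λ) k z)
        (guarded (IsPureGauge fun e => s (k e) * j (z e)) 1) =
      guarded (cond k) (∑ z : Λ.E → Z, (χ z : ℂ) * guarded (holonomyHom Λ Z z = τ k) 1) := by
    intro k
    simp only [key, mul_guarded, sum_guarded]
  obtain ⟨k₀, hk₀⟩ := hχ
  have hk₁ := guarded_ne_zero.1 ((key' k₀).symm.trans_ne hk₀)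
  -- Here the residual phase is a character of the plaquette fluxes `τ k`, so the correction acts
  -- around plaquettes.
  obtain ⟨η, C, hC, hη⟩ := exists_sum_fiber_eq (holonomyHom Λ Z) χ ⟨_, hk₁.2⟩
  refine Prep.of_phase_uniform (n := 0) (f := τ) (loc := base)
    (isLocalMap_plaquette hb hD τ fun p k k' h => ?_) le_rfl
    (plaquetteSys_boundedBy hb' hZ) (density_le_ancillaBound D B)
    (fun _ => hK.trans ((le_density D B).trans (density_le_ancillaBound D B)))
    (density_mul_le D B) (1 : Λ.E → K) η⁻¹ (.done _ _ C hC ?_)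
  · change (ρ _)⁻¹ = (ρ _)⁻¹
    rw [holonomy_congr (y := fun e => s (k' e)) fun d hd => congrArg s (h d hd)]
  have key₂ : ∀ k : Λ.E → K, ((η⁻¹ (τ k) : ℂˣ) : ℂ) * ∑ z : Λ.E → Z, (χ z : ℂ) *
      guarded (splitConfig π b (mergeConfig m (joinConfig (S := sys K Λ) (A := sys Z Λ) k z)) =
        joinConfig (S := sys K Λ) (A := sys Z Λ) k z)
        (guarded (IsPureGauge fun e => s (k e) * j (z e)) 1) =
      C * guarded (IsPureGauge k) 1 := by
    intro k
    rw [key', hη, MonoidHom.inv_apply]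
    by_cases hk : IsPureGauge k
    · obtain ⟨t, ht⟩ := hk.exists_lift hs
      -- A pure gauge in the quotient lifts to a pure gauge upstairs, whose central coordinate is a
      -- solution of the flux equations.
      let z : Λ.E → Z := fun e => ρ ((s (k e))⁻¹ * coboundary t e)
      have hz : (fun e => s (k e) * j (z e)) = coboundary t := funext fun e =>
        mul_splitting hπ hρ _ (by rw [hs, ht])
      obtain ⟨h1, h2⟩ := (isPureGauge_mul_iff hjc hρ hΛ hsc _ z).1
        (hz ▸ isPureGauge_coboundary t)
      rw [guarded_pos hk, guarded_pos (p := cond k) h1,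
        guarded_pos (p := ∃ a, holonomyHom Λ Z a = τ k) ⟨z, h2⟩, mul_one, ← mul_assoc,
        Units.inv_mul, one_mul]
    · rw [guarded_neg hk, mul_zero]
      by_contra h0
      obtain ⟨h1, h2⟩ := guarded_ne_zero.1 (right_ne_zero_of_mul h0)
      obtain ⟨⟨z, h3⟩, -⟩ := guarded_ne_zero.1 (right_ne_zero_of_mul h2)
      have h4 := isPureGauge_map ((isPureGauge_mul_iff hjc hρ hΛ hsc _ z).2 ⟨h1, h3⟩) π
      simp only [ha] at h4
      exact hk h4
  exact funext key₂

/-- On simply connected lattices, the quantum double state of a group can be prepared from that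
of a central quotient. -/
theorem prep_of_central_quotient (hj : Function.Injective j) (hjc : ∀ z g, j z * g = g * j z)
    (hπs : Function.Surjective π) (hπ : ∀ g, π g = 1 ↔ ∃ z, j z = g) (hΛ : Λ.IsCellulation)
    (hsc : Λ.SimplyConnected) (hD : Λ.BoundedBy D) (hP : Nat.card P ≤ B) (hK : Nat.card K ≤ B)
    (hZ : Nat.card Z ≤ B) :
    Prep Λ.graph (2 * (D + 1)) (ancillaBound D B) (pureState P Λ) 33 (pureState K Λ) := by
  obtain ⟨ρ, hρ⟩ := hj.hasLeftInverse
  obtain ⟨s, hs⟩ := hπs.hasRightInverse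
  obtain ⟨base, hb, hb'⟩ := hΛ.exists_base hD
  have hsplit : ∀ x, s (π x) * j (ρ ((s (π x))⁻¹ * x)) = x := fun x =>
    mul_splitting hπ hρ x (hs _)
  have ha : ∀ k z, π (s k * j z) = k := fun k z => by
    rw [map_mul, hs, (hπ (j z)).2 ⟨z, rfl⟩, mul_one]
  have hb'' : ∀ k z, ρ ((s (π (s k * j z)))⁻¹ * (s k * j z)) = z := fun k z => by
    rw [ha, inv_mul_cancel_left, hρ]
  let m : K → Z → P := fun k z => s k * j z
  let b : P → Z := fun x => ρ ((s (π x))⁻¹ * x)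
  let F : (Λ.E → P) → Λ.P → Z := fun x p => ρ (holonomy x (Λ.bdry p))
  refine Prep.of_addUniform (n := 31) (A := Z) (loc := Λ.src)
    ((sys_boundedBy hD hZ).mono (density_le_ancillaBound D B)) ?_
  refine Prep.of_replace (n := 19) (S := (sys K Λ).join (sys Z Λ)) (isLocalMap_mergeConfig m)
    (isLocalMap_splitConfig π b) le_rfl
    (join_boundedBy (sys_boundedBy hD hK) (sys_boundedBy hD hZ))
    ((sys_boundedBy hD hP).mono (density_le D B)) (two_density_le D B) le_rfl
    (joinConfig (S := sys K Λ) (A := sys Z Λ) (1 : Λ.E → K) (1 : Λ.E → Z))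
    (fun w _ => splitConfig_mergeConfig ha hb'' w) ?_
  have hstate : ∀ x : Λ.E → P, guarded (mergeConfig m (splitConfig π b x) = x)
      (guarded (IsPureGauge fun e => π (x e)) 1) = guarded (IsPureGauge fun e => π (x e)) 1 :=
    fun x => guarded_pos (mergeConfig_splitConfig hsplit x) _
  refine Prep.of_eq (S := sys P Λ) (funext hstate) ?_
  refine Prep.of_measureFun (n := 12) (f := F)
    (isLocalMap_plaquette hb hD F fun p x x' h => congrArg ρ (holonomy_congr h)) le_rfl
    (plaquetteSys_boundedBy hb' hZ) (density_le_ancillaBound D B)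
    (fun _ => hP.trans ((le_density D B).trans (density_le_ancillaBound D B)))
    (density_mul_le D B) (1 : Λ.E → P) ?_
  rintro _ ⟨(x₀ : Λ.E → P), rfl, hx₀⟩
  obtain ⟨hx₀, -⟩ := guarded_ne_zero.1 hx₀
  obtain ⟨t, ht⟩ := hx₀.exists_lift hs
  -- Any configuration compatible with the outcome is a pure gauge times a central labelling `w`, so
  -- the measured fluxes are those of `w`. Dividing every edge by `j (w e)` removes them.
  let w : Λ.E → Z := fun e => ρ ((coboundary t e)⁻¹ * x₀ e)
  have hw : (fun e => coboundary t e * j (w e)) = x₀ := funext fun e => mul_splitting hπ hρ _ (ht e)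
  have hFx₀ : F x₀ = holonomyHom Λ Z w := by
    funext p
    change ρ (holonomy x₀ (Λ.bdry p)) = holonomy w (Λ.bdry p)
    rw [← hw, holonomy_mul_central hjc, (isPureGauge_coboundary t).holonomy_bdry hΛ, one_mul, hρ]
  refine Prep.of_replace (n := 0) (S := sys P Λ) (T := sys P Λ)
    (isLocalMap_edgewise fun e x => x * (j (w e))⁻¹) (isLocalMap_edgewise fun e x => x * j (w e))
    le_rfl (sys_boundedBy hD hP) (sys_boundedBy hD hP) (density_le_ancillaBound D B)
    (density_mul_le D B) (1 : Λ.E → P) ?_ (.done _ _ 1 one_ne_zero ?_)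
  · intro (x : Λ.E → P) _
    exact funext fun e => inv_mul_cancel_right _ _
  have key : ∀ y : Λ.E → P, guarded ((fun e => y e * j (w e) * (j (w e))⁻¹) = y)
      (guarded (F (fun e => y e * j (w e)) = F x₀)
        (guarded (IsPureGauge fun e => π (y e * j (w e))) 1)) = guarded (IsPureGauge y) 1 := by
    intro y
    have h1 : ∀ e, π (y e * j (w e)) = π (y e) := fun e => by
      rw [map_mul, (hπ (j (w e))).2 ⟨_, rfl⟩, mul_one]
    rw [guarded_pos (funext fun e => mul_inv_cancel_right _ _), guarded_guarded, hFx₀]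
    simp only [h1]
    refine guarded_congr ⟨?_, fun hy => ⟨?_, isPureGauge_map hy π⟩⟩ 1
    · rintro ⟨h2, h3⟩
      rw [isPureGauge_iff hΛ hsc]
      intro p
      have h4 : ρ (holonomy (fun e => y e * j (w e)) (Λ.bdry p)) = holonomy w (Λ.bdry p) :=
        congrFun h2 p
      -- The holonomy of `y` is trivial in the quotient, hence central, so the left inverse `ρ`
      -- detects it faithfully.
      obtain ⟨ζ, hζ⟩ := (hπ (holonomy y (Λ.bdry p))).1 (by
        rw [map_holonomy]
        exact h3.holonomy_bdry hΛ p)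
      rw [holonomy_mul_central hjc, ← hζ, ← map_mul, hρ, mul_eq_right] at h4
      rw [← hζ, h4, map_one]
    · funext p
      change ρ (holonomy (fun e => y e * j (w e)) (Λ.bdry p)) = holonomy w (Λ.bdry p)
      rw [holonomy_mul_central hjc, hy.holonomy_bdry hΛ, one_mul, hρ]
  rw [one_smul]
  exact funext key

end Central

end QuantumDouble

end

/-! ### The derived series and assembly of the phases. -/

section

theorem perfectCore_le_derivedSeries (G : Type) [Group G] (n : ℕ) :
    perfectCore G ≤ derivedSeries G n := by
  induction n with
  | zero => exact le_top
  | succ n ih =>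
    have h : ⁅perfectCore G, perfectCore G⁆ = perfectCore G := (isGreatest_perfectCore G).1
    rw [derivedSeries_succ, ← h]
    exact Subgroup.commutator_mono ih ih

/-- The descending series cannot strictly decrease forever in a finite group. A term equal to its
successor is perfect, hence contained in the core, and every term contains the core. -/
theorem exists_derivedSeries_eq_perfectCore (G : Type) [Group G] [Finite G] :
    ∃ n, derivedSeries G n = perfectCore G := by
  obtain ⟨n, hn⟩ : ∃ n, derivedSeries G (n + 1) = derivedSeries G n := by
    by_contra! h
    exact not_strictAnti_of_wellFoundedLT _ (strictAnti_nat_of_succ_lt fun n =>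
      lt_of_le_of_ne (derivedSeries_antitone G n.le_succ) (h n))
  exact ⟨n, le_antisymm ((isGreatest_perfectCore G).2 hn) (perfectCore_le_derivedSeries G n)⟩

open QSystem

namespace QuantumDouble

variable {ι : Type} {Λ : ι → SpaceLattice}

theorem prep_gs_of_prep_pureState {H : Type} [Group H] [Fintype H] {Λ : SpaceLattice}
    (hΛ : Λ.IsCellulation) {R K n : ℕ} {S : QSystem Λ.V} {ψ : S.State}
    (h : Prep Λ.graph R K (pureState H Λ) n ψ) : Prep Λ.graph R K (gs H Λ) n ψ := by
  obtain ⟨c, hc, hgs⟩ := gs_eq (G := H) hΛ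
  refine h.trans (m := 0) (.done _ _ c⁻¹ (inv_ne_zero hc) ?_)
  rw [hgs, smul_smul, inv_mul_cancel₀ hc, one_smul]

theorem prepares_of_prep_pureState {G H : Type} [Group G] [Fintype G] [Group H] [Fintype H]
    (hΛ : ∀ i, (Λ i).IsCellulation) {R K n : ℕ}
    (h : ∀ i, Prep (Λ i).graph R K (pureState H (Λ i)) n (pureState G (Λ i))) :
    (family G Λ).Prepares (family H Λ) := by
  refine ⟨n, R, K, fun i => ?_⟩
  obtain ⟨c, hc, hgs⟩ := gs_eq (G := G) (hΛ i)
  exact Prep.of_eq hgs ((prep_gs_of_prep_pureState (hΛ i) (h i)).smul c hc)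

/-- Extensions by abelian groups do not change the phase. -/
theorem measurementEquivalent_of_exact {N G Q : Type} [Group N] [Group G] [CommGroup Q]
    [Fintype N] [Fintype G] [Finite Q] (j : N →* G) (π : G →* Q) (hj : Function.Injective j)
    (hπs : Function.Surjective π) (hπ : ∀ g, π g = 1 ↔ ∃ n, j n = g) (hΛ : IsLatticeFamily Λ) :
    (family G Λ).MeasurementEquivalent (family N Λ) := by
  have := Fintype.ofFinite Q
  obtain ⟨hΛ, D, hD⟩ := hΛ
  let B := Nat.card N + Nat.card G + Nat.card Q
  have hN : Nat.card N ≤ B := by simp only [B]; omega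
  have hG : Nat.card G ≤ B := by simp only [B]; omega
  have hQ : Nat.card Q ≤ B := by simp only [B]; omega
  exact ⟨prepares_of_prep_pureState hΛ fun i => prep_of_exact j π hj hπ (hΛ i) (hD i) hN hG hQ,
    prepares_of_prep_pureState hΛ fun i =>
      prep_of_exact_abelian j π hj hπs hπ (hΛ i) (hD i) hN hG hQ⟩

/-- On simply connected lattices, central extensions do not change the phase. -/
theorem measurementEquivalent_of_central {P K Z : Type} [Group P] [Group K] [CommGroup Z]
    [Fintype P] [Fintype K] [Finite Z] (j : Z →* P) (π : P →* K) (hj : Function.Injective j)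
    (hjc : ∀ z g, j z * g = g * j z) (hπs : Function.Surjective π)
    (hπ : ∀ g, π g = 1 ↔ ∃ z, j z = g) (hΛ : IsLatticeFamily Λ)
    (hsc : ∀ i, (Λ i).SimplyConnected) :
    (family P Λ).MeasurementEquivalent (family K Λ) := by
  have := Fintype.ofFinite Z
  obtain ⟨hΛ, D, hD⟩ := hΛ
  let B := Nat.card P + Nat.card K + Nat.card Z
  have hP : Nat.card P ≤ B := by simp only [B]; omega
  have hK : Nat.card K ≤ B := by simp only [B]; omega
  have hZ : Nat.card Z ≤ B := by simp only [B]; omega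
  exact ⟨prepares_of_prep_pureState hΛ fun i =>
      prep_quotient_of_central hj hjc hπs hπ (hΛ i) (hsc i) (hD i) hP hK hZ,
    prepares_of_prep_pureState hΛ fun i =>
      prep_of_central_quotient hj hjc hπs hπ (hΛ i) (hsc i) (hD i) hP hK hZ⟩

/-- The abelianization of `H` is the abelian quotient, with kernel the commutator subgroup. -/
theorem measurementEquivalent_commutator {G : Type} [Group G] {H K : Subgroup G} [Fintype H]
    [Fintype K] (hK : ⁅H, H⁆ = K) (hΛ : IsLatticeFamily Λ) :
    (family H Λ).MeasurementEquivalent (family K Λ) := by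
  have hKH : K ≤ H := hK ▸ Subgroup.commutator_le_self H
  have hof : ∀ g : H, (Abelianization.of g = 1 ↔ ∃ n, Subgroup.inclusion hKH n = g) := by
    intro g
    have h1 : Abelianization.of g = 1 ↔ g ∈ commutator H := QuotientGroup.eq_one_iff g
    rw [h1, ← Subgroup.mem_map_iff_mem H.subtype_injective, Subgroup.map_subtype_commutator, hK]
    constructor
    · intro h
      exact ⟨⟨g, h⟩, rfl⟩
    · rintro ⟨h, rfl⟩
      exact h.2
  exact measurementEquivalent_of_exact (N := K) (G := H) (Q := Abelianization H)
    (Subgroup.inclusion hKH) Abelianization.of (Subgroup.inclusion_injective hKH)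
    (QuotientGroup.mk'_surjective _) hof hΛ

theorem measurementEquivalent_derivedSeries (G : Type) [Group G] [Fintype G]
    (hΛ : IsLatticeFamily Λ) (n : ℕ) :
    ∀ (H : Subgroup G) [Fintype H], derivedSeries G n = H →
      (family G Λ).MeasurementEquivalent (family H Λ) := by
  induction n with
  | zero =>
    rintro H _ rfl
    -- The group and its top subgroup are different types; they are linked by the extension with
    -- trivial quotient.
    refine measurementEquivalent_of_exact (Q := PUnit) (Subgroup.subtype _) 1
      (Subgroup.subtype_injective _) (fun _ => ⟨1, rfl⟩) (fun g => ?_) hΛ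
    exact ⟨fun _ => ⟨⟨g, Subgroup.mem_top g⟩, rfl⟩, fun _ => rfl⟩
  | succ n ih =>
    intro H _ hH
    have := Fintype.ofFinite (derivedSeries G n)
    exact (ih _ rfl).trans (measurementEquivalent_commutator hH hΛ)

theorem measurementEquivalent_perfectCore (G : Type) [Group G] [Fintype G]
    (hΛ : IsLatticeFamily Λ) :
    (family G Λ).MeasurementEquivalent (family (perfectCore G) Λ) := by
  obtain ⟨n, hn⟩ := exists_derivedSeries_eq_perfectCore G
  exact measurementEquivalent_derivedSeries G hΛ n _ hn

theorem isProduct_pureState {G : Type} [Group G] [Fintype G] [Subsingleton G] (Λ : SpaceLattice) :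
    IsProduct (pureState G Λ) := by
  refine ⟨fun _ _ => 1, fun e h => one_ne_zero (congrFun h (1 : G)), fun x => ?_⟩
  rw [Finset.prod_const_one, show x = (1 : Λ.E → G) from
    funext fun e => Subsingleton.elim (α := G) _ _]
  exact guarded_pos isPureGauge_one 1

theorem inTrivialPhase_of_isSolvable {G : Type} [Group G] [Fintype G] (hG : Group.IsSolvable G)
    (hΛ : IsLatticeFamily Λ) : (family G Λ).InTrivialPhase := by
  intro F' hF' hK
  obtain ⟨K, hK⟩ := hK
  -- A product state can be prepared from any state. For the other direction, the state of the
  -- trivial perfect core is itself a product, and the state of `G` is prepared from it.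
  refine ⟨⟨3, 0, K, fun i => Prep.of_isProduct (hK i) (hF' i) _⟩,
    StateFamily.Prepares.trans ?_ (measurementEquivalent_perfectCore G hΛ).2⟩
  have hbot : perfectCore G = ⊥ := by
    obtain ⟨n, hn⟩ := hG.solvable
    exact le_bot_iff.1 (hn ▸ perfectCore_le_derivedSeries G n)
  have : Subsingleton (perfectCore G) := by
    rw [hbot]
    infer_instance
  obtain ⟨hΛ, D, hD⟩ := hΛ
  exact ⟨3, 0, density D (Nat.card (perfectCore G)), fun i =>
    prep_gs_of_prep_pureState (hΛ i)
      (Prep.of_isProduct (sys_boundedBy (hD i) le_rfl) (isProduct_pureState (Λ i)) _)⟩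

end QuantumDouble

end

end

theorem mainTheorem9 (G : Type) [Group G] [Fintype G] :
    -- the central quotient of the perfect core is perfect and centerless
    (Group.IsPerfect (PerfectCenterless G) ∧ Subgroup.center (PerfectCenterless G) = ⊥) ∧
    -- the quantum double state is a ground state, the only one on a simply connected lattice
    (∀ Λ : SpaceLattice, Λ.IsCellulation →
      QuantumDouble.IsGroundState (QuantumDouble.gs G Λ) ∧
      (Λ.SimplyConnected → ∀ ψ : (QuantumDouble.sys G Λ).State,
        QuantumDouble.IsGroundState ψ → ∃ c : ℂ, ψ = c • QuantumDouble.gs G Λ)) ∧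
    -- `D(G)` and `D(G_pc)` are in the same measurement-equivalent phase
    (∀ (ι : Type) (Λ : ι → SpaceLattice), IsLatticeFamily Λ → (∀ i, (Λ i).SimplyConnected) →
      (QuantumDouble.family G Λ).MeasurementEquivalent
        (QuantumDouble.family (PerfectCenterless G) Λ)) ∧
    -- on lattices of arbitrary topology, `D(G)` and `D(G_p)` are
    (∀ (ι : Type) (Λ : ι → SpaceLattice), IsLatticeFamily Λ →
      (QuantumDouble.family G Λ).MeasurementEquivalent
        (QuantumDouble.family (perfectCore G) Λ)) ∧
    -- solvable quantum doubles are in the trivial phase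
    (Group.IsSolvable G → ∀ (ι : Type) (Λ : ι → SpaceLattice), IsLatticeFamily Λ →
      (QuantumDouble.family G Λ).InTrivialPhase) := by
  have hp : Group.IsPerfect (perfectCore G) :=
    Subgroup.isPerfect_iff.2 (isGreatest_perfectCore G).1
  -- Perfectness passes to quotients, and Grün's lemma says that a perfect group modulo its center
  -- has trivial center.
  refine ⟨⟨inferInstance, Group.IsPerfect.center_quotient_center_eq_bot _⟩, fun Λ hΛ =>
    ⟨QuantumDouble.isGroundState_gs hΛ, fun hs ψ hψ => hψ.eq_smul_gs hΛ hs⟩,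
    fun ι Λ hΛ hs => ?_,
    fun ι Λ hΛ => QuantumDouble.measurementEquivalent_perfectCore G hΛ,
    fun hG ι Λ hΛ => QuantumDouble.inTrivialPhase_of_isSolvable hG hΛ⟩
  let _ : CommGroup (Subgroup.center (perfectCore G)) :=
    { (inferInstance : Group (Subgroup.center (perfectCore G))) with
      mul_comm := fun z w => Subtype.ext (Subgroup.mem_center_iff.1 w.2 z) }
  have hker : ∀ g : perfectCore G, QuotientGroup.mk' (Subgroup.center (perfectCore G)) g = 1 ↔
      ∃ z, (Subgroup.center (perfectCore G)).subtype z = g := fun g =>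
    (QuotientGroup.eq_one_iff g).trans
      ⟨fun h => ⟨⟨g, h⟩, rfl⟩, fun ⟨z, hz⟩ => hz ▸ z.2⟩
  exact (QuantumDouble.measurementEquivalent_perfectCore G hΛ).trans
    (QuantumDouble.measurementEquivalent_of_central
      (P := perfectCore G) (K := PerfectCenterless G) (Z := Subgroup.center (perfectCore G))
      (Subgroup.center (perfectCore G)).subtype (QuotientGroup.mk' _)
      (Subgroup.subtype_injective _) (fun z g => (Subgroup.mem_center_iff.1 z.2 g).symm)
      (QuotientGroup.mk'_surjective _) hker hΛ hs)
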